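/- **Setting.** A Block MDP has a finite latent state space $\mathcal S$ ($S=|\mathcal S|$), a finite action set $\mathcal A$ ($A=|\mathcal A|$), a countable observation space $\mathcal X$, transitions $T(\cdot\mid s,a)$, rewards $R(s,a)\in[0,1]$, emissions $q(\cdot\mid s)$ with disjoint supports (so there is a decoder $\phi^\star:\mathcal X\to\mathcal S$ with $\phi^\star(x)=s$ for $x\sim q(\cdot\mid s)$), an initial distribution $\mu$ and a horizon $H\ge1$. Videos are sequences of observations of length $H+K$ with law $D$, a mixture of Markovian policies; $\omega$ is a distribution on the lags $[K]$ (for instance a point mass or the uniform distribution). Let $$\rho(x)=\tfrac1H\sum_{h=1}^H D(x_h=x),\qquad D_k(x,x')=\tfrac1H\sum_{h=1}^H D(x_h=x,\,x_{h+k}=x'),\qquad D(s'\mid s,k)=D_k\big(\phi^\star(X')=s'\mid\phi^\star(X)=s\big),$$ and $\rho(s)=\rho(\phi^\star(X)=s)$. A contrastive data point $(x,k,x',z)\sim D_{\rm cont}$ is made from two independent videos $v,w$: draw $k\sim\omega$, $z\sim{\rm Unf}\{0,1\}$, $h,h'\sim{\rm Unf}[H]$ independently and set $x=v_h$, and $x'=v_{h+k}$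 if $z=1$, $x'=w_{h'}$ if $z=0$. From $n\ge2$ iid videos one obtains $\lfloor n/2\rfloor$ iid data points. Let $N=S$, let $\mathcal G$ be a finite class of functions $[N]\times[K]\times\mathcal X\to[0,1]$ and $\Phi$ a finite class of decoders $\mathcal X\to[N]$, and let $(\hat g,\hat\phi)$ be any minimizer over $\mathcal G\times\Phi$ of the empirical square loss $\frac1{\lfloor n/2\rfloor}\sum_i\big(g(\phi(x^{(i)}),k^{(i)},x'^{(i)})-z^{(i)}\big)^2$. **Assumptions.** 1. Coverage: for a policy class $\Pi$ and some $\eta_{\min}>0$, if a state $s$ is reached at step $h\in[H]$ with positive probability by some $\pi\in\Pi$, then $D(\phi^\star(x_h)=s)\ge\eta_{\min}$; and every $s\in\mathcal S$ is so reached at some step $h\in[H]$. 2. The data collection policies are noise-free: on the observations they encounter, $\pi(a\mid x_h)=\pi(a\mid\phi^\star(x_h))$. 3. Realizability: there are $g^\star\in\mathcal G$, $\phi^\circ\in\Phi$ with $g^\star(\phi^\circ(x),k,x')=D_{\rm cont}(z=1\mid x,k,x')$ on the support of $D_{\rm cont}$; write $g^\star(x,k,x')=g^\star(\phi^\circ(x),k,x')$.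 4. Margin: $\beta_{\rm temp}>0$ and for all $s_1\ne s_2$, $\ \frac12\mathbb E_{k\sim\omega,s'\sim\rho}\big[|D_{\rm cont}(z=1\mid s_1,k,s')-D_{\rm cont}(z=1\mid s_2,k,s')|\big]\ge\beta_{\rm temp}$. Let $\delta\in(0,1)$ and $\Delta_{\rm cont}=\sqrt{\frac2n\ln\frac{|\mathcal G||\Phi|}{\delta}}$. Then: **(a)** For all $(x,k,x')$ in the support of $D_{\rm cont}$, with $s=\phi^\star(x)$, $s'=\phi^\star(x')$, $$D_{\rm cont}(z=1\mid x,k,x')=\frac{D(s'\mid s,k)}{D(s'\mid s,k)+\rho(s')}.$$ **(b)** With probability at least $1-\delta$ over the data, both $$\mathbb E_{x_1,x_2\sim\rho,\;k\sim\omega,\;x'\sim\rho}\Big[\mathbf 1\{\hat\phi(x_1)=\hat\phi(x_2)\}\,\big|g^\star(x_1,k,x')-g^\star(x_2,k,x')\big|\Big]<4\Delta_{\rm cont}$$ (all four variables independent) and $$\mathbb P_{x_1,x_2\sim\rho}\big(\hat\phi(x_1)=\hat\phi(x_2)\wedge\phi^\star(x_1)\ne\phi^\star(x_2)\big)\le\frac{2\Delta_{\rm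 cont}}{\beta_{\rm temp}}.$$ **(c)** There is a universal constant $C>0$ such that the following holds. Let $\mathscr A$ be any PAC RL algorithm for tabular MDPs with sample complexity $n_{\rm samp}(S,A,H,\epsilon,\delta)$, that is, after that many episodes in any tabular MDP it returns, with probability at least $1-\delta$, an $\epsilon$-optimal (time-dependent) policy. Let $\epsilon>0$, write $n_{\rm s}=n_{\rm samp}(S,A,H,\epsilon/2,\delta/4)$, and let $$n\ \ge\ C\left\{\frac{S^4H^4}{\eta_{\min}^4\beta_{\rm temp}^2}+\frac{S^6H^8}{\epsilon^2\eta_{\min}^4\beta_{\rm temp}^2}+\frac{S^6H^6\,n_{\rm s}^2}{\delta^2\eta_{\min}^4\beta_{\rm temp}^2}\right\}\ln\frac{|\mathcal G||\Phi|}{\delta}.$$ Freeze $\hat\phi$ and run $\mathscr A$, with parameters $(\epsilon/2,\delta/4)$, in the Block MDP with $\hat\phi(x)$ in place of $x$; let $\hat\varphi$ be the policy it returns. Then with probability at least $1-\delta$ over the video data and the downstream interaction there is a bijection $\alpha:\mathcal S\to[S]$ (which may depend on the data) with $$\forall s\in\mathcal S:\quad \mathbb P_{x\sim q(\cdot\mid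 s)}\big(\hat\phi(x)=\alpha(s)\big)\ \ge\ 1-\frac{4S^3H^2}{\eta_{\min}^2\beta_{\rm temp}}\sqrt{\frac1n\ln\frac{|\mathcal G||\Phi|}{\delta}},$$ and $V(\pi)-V(\hat\varphi\circ\hat\phi)\le\epsilon$ for every observation-based policy $\pi$, where $V$ is the expected total reward over $H$ steps. The number of online episodes used is exactly $n_{\rm s}$, which does not depend on $\Phi$ or $\mathcal G$. -/

import Mathlib

namespace VideoRL

/-- Probability of an event under a discrete distribution, as a real number. -/
noncomputable def prob {α : Type*} (p : PMF α) (E : Set α) : ℝ :=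
  (p.toOuterMeasure E).toReal

/-- Expectation of a real function under a discrete distribution. It is only used below for
bounded functions, for which the series converges absolutely. -/
noncomputable def expect {α : Type*} (p : PMF α) (f : α → ℝ) : ℝ :=
  ∑' a, (p a).toReal * f a

/-- `m` independent samples from `p`. -/
noncomputable def iid {α : Type*} (p : PMF α) : (m : ℕ) → PMF (Fin m → α)
  | 0 => PMF.pure Fin.elim0
  | m + 1 => p.bind fun a => (iid p m).map fun v => Fin.cons a v

/-! ### Decision processes -/

/-- A tabular MDP (the horizon is supplied separately). -/
structure TabularMDP (S A : Type*) where
  /-- initial state distribution -/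
  init : PMF S
  /-- transition dynamics -/
  trans : S → A → PMF S
  /-- reward function -/
  reward : S → A → ℝ
  reward_nonneg : ∀ s a, 0 ≤ reward s a
  reward_le_one : ∀ s a, reward s a ≤ 1

/-- A Block MDP: a latent tabular MDP, an emission function, and the decoder `φ⋆`, whose
existence is the disjoint emission property. -/
structure BlockMDP (X S A : Type*) extends TabularMDP S A where
  /-- emission distributions `q (· ∣ s)` -/
  emit : S → PMF X
  /-- true decoder `φ⋆` -/
  decode : X → S
  decode_emit : ∀ s x, x ∈ (emit s).support → decode x = s

/-- A tabular MDP is a Block MDP whose state is observed. -/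
noncomputable def TabularMDP.toBlock {S A : Type*} (M : TabularMDP S A) : BlockMDP S S A where
  toTabularMDP := M
  emit := PMF.pure
  decode := id
  decode_emit := by
    intro s x hx
    simpa using hx

/-- What the agent records in one episode: `(o₁, a₁, r₁), (o₂, a₂, r₂), …`. -/
abbrev Episode (O A : Type*) := List (O × A × ℝ)

namespace BlockMDP

variable {X S A O : Type*}

/-- Continue an episode for the given number of steps from latent state `s`, after the record
`past`. The agent sees `φ x` in place of the observation `x`; its action may depend on the
record of the episode so far. -/
noncomputable def episodeFrom (M : BlockMDP X S A) (φ : X → O)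
    (act : Episode O A → O → PMF A) : ℕ → Episode O A → S → PMF (Episode O A)
  | 0, past, _ => PMF.pure past
  | L + 1, past, s =>
      (M.emit s).bind fun x => (act past (φ x)).bind fun a => (M.trans s a).bind fun s' =>
        M.episodeFrom φ act L (past ++ [(φ x, a, M.reward s a)]) s'

/-- Law of one episode with `H` actions. -/
noncomputable def episode (M : BlockMDP X S A) (H : ℕ) (φ : X → O)
    (act : Episode O A → O → PMF A) : PMF (Episode O A) :=
  M.init.bind fun s => M.episodeFrom φ act H [] s

/-- The value `V(π)`: expected total reward over `H` steps. The action in step `h` (counted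
from `0`) is `π h x`. -/
noncomputable def value (M : BlockMDP X S A) (H : ℕ) (π : ℕ → X → A) : ℝ :=
  expect (M.episode H id fun past x => PMF.pure (π past.length x))
    fun e => (e.map fun t => t.2.2).sum

/-- The observations of `L` consecutive steps, the first one in step `h` from latent state
`s`, when actions follow the Markovian policy `π`. -/
noncomputable def videoFrom (M : BlockMDP X S A) (π : ℕ → X → PMF A) :
    (L : ℕ) → ℕ → S → PMF (Fin L → X)
  | 0, _, _ => PMF.pure Fin.elim0
  | L + 1, h, s =>
      (M.emit s).bind fun x => (π h x).bind fun a => (M.trans s a).bind fun s' =>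
        (M.videoFrom π L (h + 1) s').map fun v => Fin.cons x v

/-- Law of the observations `(x₁, …, x_L)` of an episode of length `L` under `π`. -/
noncomputable def video (M : BlockMDP X S A) (π : ℕ → X → PMF A) (L : ℕ) : PMF (Fin L → X) :=
  M.init.bind fun s => M.videoFrom π L 0 s

end BlockMDP

/-! ### Episodic algorithms for tabular MDPs -/

/-- A (randomized) episodic learning algorithm: it picks actions as a function of the completed
episodes, of the record of the current episode and of the current observation, and in the end
returns a time-dependent policy. -/
structure EpisodicAlg (O A : Type*) where
  act : List (Episode O A) → Episode O A → O → PMF A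
  output : List (Episode O A) → PMF (ℕ → O → A)

/-- Law of the episodes seen when `alg` interacts for `m` episodes with `M` through `φ`. -/
noncomputable def interact {X S A O : Type*} (M : BlockMDP X S A) (H : ℕ) (φ : X → O)
    (alg : EpisodicAlg O A) : ℕ → PMF (List (Episode O A))
  | 0 => PMF.pure []
  | m + 1 => (interact M H φ alg m).bind fun log =>
      (M.episode H φ (alg.act log)).map fun e => log ++ [e]

/-- Joint law of the `m` episodes and of the returned policy. -/
noncomputable def runAlg {X S A O : Type*} (M : BlockMDP X S A) (H : ℕ) (φ : X → O)
    (alg : EpisodicAlg O A) (m : ℕ) : PMF (List (Episode O A) × (ℕ → O → A)) :=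
  (interact M H φ alg m).bind fun log => (alg.output log).map fun ψ => (log, ψ)

/-- `alg` (which is told the number of states, the horizon, the tolerance and the failure
probability) is a PAC RL algorithm for tabular MDPs with action set `A`, with sample complexity
`nsamp S A H ε δ`. -/
def IsPAC {A : Type*} [Fintype A] (alg : (N _H : ℕ) → (_ε _δ : ℝ) → EpisodicAlg (Fin N) A)
    (nsamp : (_S _A _H : ℕ) → (_ε _δ : ℝ) → ℕ) : Prop :=
  ∀ (N H : ℕ) (ε δ : ℝ), 0 < ε → 0 < δ → δ < 1 → ∀ M : TabularMDP (Fin N) A,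
    1 - δ ≤ prob (runAlg M.toBlock H id (alg N H ε δ) (nsamp N (Fintype.card A) H ε δ))
      {r | ∀ ψ : ℕ → Fin N → A, M.toBlock.value H ψ - M.toBlock.value H r.2 ≤ ε}

/-! ### Video data and temporal contrastive learning -/

/-- The data-generating process: a Block MDP, a mixture over Markovian data collection
policies, and the law `ω` of the lag. The element `k : Fin K` stands for the lag `k + 1`, so that
`Fin K` is `[K]`; steps are counted from `0`. -/
structure VideoProcess (X S A : Type*) (H K : ℕ) where
  env : BlockMDP X S A
  /-- mixture distribution over data collection policies -/
  mix : PMF (ℕ → X → PMF A)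
  /-- distribution of the lag -/
  lag : PMF (Fin K)

/-- Position of the frame `k + 1` steps after frame `h`. -/
def later {H K : ℕ} (h : Fin H) (k : Fin K) : Fin (H + K) :=
  ⟨h + k + 1, by omega⟩

namespace VideoProcess

variable {X S A : Type*} {H K : ℕ}

/-- The video distribution `D` (episodes run until step `H + K`). -/
noncomputable def video (P : VideoProcess X S A H K) : PMF (Fin (H + K) → X) :=
  P.mix.bind fun π => P.env.video π (H + K)

/-- `ρ`: the observation in a uniformly random step in `[H]`. -/
noncomputable def rho [NeZero H] (P : VideoProcess X S A H K) : PMF X :=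
  P.video.bind fun v => (PMF.uniformOfFintype (Fin H)).map fun h => v (Fin.castAdd K h)

/-- `ρ(s)`. -/
noncomputable def rhoState [NeZero H] (P : VideoProcess X S A H K) (s : S) : ℝ :=
  prob P.rho {x | P.env.decode x = s}

/-- `D_k`: a pair of observations of one video, at lag `k`, started in a uniformly random
step in `[H]`. -/
noncomputable def pair [NeZero H] (P : VideoProcess X S A H K) (k : Fin K) : PMF (X × X) :=
  P.video.bind fun v =>
    (PMF.uniformOfFintype (Fin H)).map fun h => (v (Fin.castAdd K h), v (later h k))

/-- `D(s' ∣ s, k)`: conditional law of the latent state of the later observation. -/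
noncomputable def stateStep [NeZero H] (P : VideoProcess X S A H K)
    (s : S) (k : Fin K) (s' : S) : ℝ :=
  prob (P.pair k) {p | P.env.decode p.1 = s ∧ P.env.decode p.2 = s'} /
    prob (P.pair k) {p | P.env.decode p.1 = s}

/-- `D_cont`: one contrastive data point `(x, k, x', z)`, made from two independent videos. -/
noncomputable def cont [NeZero H] (P : VideoProcess X S A H K) :
    PMF (X × Fin K × X × Bool) :=
  P.video.bind fun v => P.video.bind fun w => P.lag.bind fun k =>
    (PMF.uniformOfFintype Bool).bind fun z =>
      (PMF.uniformOfFintype (Fin H)).bind fun h =>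
        (PMF.uniformOfFintype (Fin H)).map fun h' =>
          (v (Fin.castAdd K h), k,
            (if z then v (later h k) else w (Fin.castAdd K h')), z)

/-- `(x, k, x')` is in the support of the marginal of `D_cont`. -/
def InSupport [NeZero H] (P : VideoProcess X S A H K) (x : X) (k : Fin K) (x' : X) : Prop :=
  ∃ z : Bool, (x, k, x', z) ∈ P.cont.support

/-- The Bayes classifier `D_cont(z = 1 ∣ x, k, x')`. -/
noncomputable def bayes [NeZero H] (P : VideoProcess X S A H K)
    (x : X) (k : Fin K) (x' : X) : ℝ :=
  (P.cont (x, k, x', true)).toReal /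
    ((P.cont (x, k, x', true)).toReal + (P.cont (x, k, x', false)).toReal)

/-- The Bayes classifier in terms of the latent states, `D_cont(z = 1 ∣ s, k, s')`. -/
noncomputable def bayesState [NeZero H] (P : VideoProcess X S A H K)
    (s : S) (k : Fin K) (s' : S) : ℝ :=
  prob P.cont {t | P.env.decode t.1 = s ∧ t.2.1 = k ∧ P.env.decode t.2.2.1 = s' ∧
      t.2.2.2 = true} /
    prob P.cont {t | P.env.decode t.1 = s ∧ t.2.1 = k ∧ P.env.decode t.2.2.1 = s'}

/-- `D_coup`: `x₁, x₂, x'` drawn from `ρ` and `k` from `ω`, independently. -/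
noncomputable def coup [NeZero H] (P : VideoProcess X S A H K) :
    PMF (X × X × Fin K × X) :=
  P.rho.bind fun x₁ => P.rho.bind fun x₂ => P.lag.bind fun k =>
    P.rho.map fun x' => (x₁, x₂, k, x')

/-- Two independent observations from `ρ`. -/
noncomputable def twoRho [NeZero H] (P : VideoProcess X S A H K) : PMF (X × X) :=
  P.rho.bind fun x₁ => P.rho.map fun x₂ => (x₁, x₂)

/-- Every state is visited in some step in `[H]` by some policy of the class `Π`, and every state
which a policy of `Π` visits in step `h` has probability at least `η` in step `h` of a video. -/
def Coverage (P : VideoProcess X S A H K) (Pol : Set (ℕ → X → A)) (η : ℝ) : Prop :=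
  (∀ s : S, ∃ h : Fin H, ∃ π ∈ Pol,
    0 < prob (P.env.video (fun i x => PMF.pure (π i x)) H) {v | P.env.decode (v h) = s}) ∧
  ∀ (s : S) (h : Fin H), (∃ π ∈ Pol,
    0 < prob (P.env.video (fun i x => PMF.pure (π i x)) H) {v | P.env.decode (v h) = s}) →
      η ≤ prob P.video {v | P.env.decode (v (Fin.castAdd K h)) = s}

/-- The data collection policies are noise-free: on observations that they encounter in step `h`,
the law of the action depends on the observation only through its latent state. -/
def NoiseFree (P : VideoProcess X S A H K) : Prop :=
  ∀ π ∈ P.mix.support, ∀ h : Fin (H + K),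
    ∀ v ∈ (P.env.video π (H + K)).support, ∀ w ∈ (P.env.video π (H + K)).support,
      P.env.decode (v h) = P.env.decode (w h) → π h (v h) = π h (w h)

/-- `β > 0` is a lower bound for the temporal contrastive margin. -/
def Margin [NeZero H] [Fintype S] (P : VideoProcess X S A H K) (β : ℝ) : Prop :=
  0 < β ∧ ∀ s₁ s₂ : S, s₁ ≠ s₂ →
    β ≤ 1 / 2 * ∑ k : Fin K, ∑ s' : S, (P.lag k).toReal * P.rhoState s' *
      |P.bayesState s₁ k s' - P.bayesState s₂ k s'|

end VideoProcess

/-- The empirical square loss of `(g, φ)` on `m` data points `(x, k, x', z)`. -/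
noncomputable def contLoss {X : Type*} {N K m : ℕ}
    (data : Fin m → X × Fin K × X × Bool)
    (g : Fin N → Fin K → X → Set.Icc (0 : ℝ) 1) (φ : X → Fin N) : ℝ :=
  1 / (m : ℝ) * ∑ i, ((g (φ (data i).1) (data i).2.1 (data i).2.2.1 : ℝ) -
    (if (data i).2.2.2 then 1 else 0)) ^ 2

/-- `erm` returns, for every data set, a minimizer of the empirical loss over `G × Φ` (with an
arbitrary rule for ties). -/
def IsERM {X : Type*} {N K m : ℕ} (G : Finset (Fin N → Fin K → X → Set.Icc (0 : ℝ) 1))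
    (Φ : Finset (X → Fin N))
    (erm : (Fin m → X × Fin K × X × Bool) →
      (Fin N → Fin K → X → Set.Icc (0 : ℝ) 1) × (X → Fin N)) : Prop :=
  ∀ data, (erm data).1 ∈ G ∧ (erm data).2 ∈ Φ ∧
    ∀ g ∈ G, ∀ φ ∈ Φ, contLoss data (erm data).1 (erm data).2 ≤ contLoss data g φ

/-- Joint law of the contrastive data set, of the downstream episodes and of the latent policy
returned downstream, when the decoder learned from the data set is frozen and `alg` is run through
it for `m'` episodes. -/
noncomputable def pipeline {X S A : Type*} {H K N m : ℕ} [NeZero H]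
    (P : VideoProcess X S A H K)
    (learn : (Fin m → X × Fin K × X × Bool) → X → Fin N) (alg : EpisodicAlg (Fin N) A)
    (m' : ℕ) :
    PMF ((Fin m → X × Fin K × X × Bool) × List (Episode (Fin N) A) × (ℕ → Fin N → A)) :=
  (iid P.cont m).bind fun data => (runAlg P.env H (learn data) alg m').map fun r => (data, r)

end VideoRL

open VideoRL

/-! Part (a) rests on resampling. If the policies are noise-free, redrawing one frame of a video
from the emission law of its latent state does not change the video law (`eexp_video_resample`). So
`ρ(x)` and `D_k(x, x')` are emission probabilities times latent-state probabilities (`rho_apply`,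
`pair_apply`), and the emission factors cancel in the Bayes ratio (`bayes_eq`).

Part (b) is a Chernoff and union bound for the exponential moment of the excess square loss. Its
core is the pointwise inequality `exp_excess_loss_le`, whose gain is linear in `|f - p|` and carries
the weight `1 - p = D_cont(z = 0 ∣ x, k, x')`. The weight turns `D_cont` into the law of the
negative examples, which is exactly the product of `ρ`, `ω` and `ρ`; linearity gives an `L¹` bound
without a Cauchy–Schwarz step. When `φ̂` merges `x₁` and `x₂`, the learned classifier takes the same
value at both, and the triangle inequality through this value costs a factor 2
(`ofReal_mergeGap_le`). The Bayes classifier depends only on latent states, so by the margin each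
merged pair of different states contributes at least `2β` (`prob_merge_le`).

For part (c), coverage gives `ρ(s) ≥ η / H`, so a small merging probability means that the label
distributions of two different states hardly overlap. A pigeonhole argument then yields a bijection
of states and labels that is right with probability at least `1 - ξ` in every state
(`exists_equiv_of_mul_le`). Keeping only runs without decoding errors, the law of `m` episodes seen
through `φ̂` is at least `(1 - ξ) ^ (H * m)` times that in the relabeled latent MDP
(`eexp_runAlg_ge`). The PAC guarantee thus transfers with a loss `H * m * ξ` in probability, and `H
^ 2 * ξ` in value (`value_comp_ge`). Latent policies suffice as competitors by dynamic programming
(`exists_policy_value_ge`).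

Expectations are taken in `ℝ≥0∞`, where sums can be exchanged without summability conditions. -/

namespace VideoRL

open scoped ENNReal

/-! ### Calculus of expectations in `ℝ≥0∞`. -/

section Expectation

variable {α β : Type*}

/-- Expectation of an extended nonnegative function under a discrete distribution. -/
noncomputable def eexp (p : PMF α) (f : α → ℝ≥0∞) : ℝ≥0∞ := ∑' a, p a * f a

theorem eexp_bind (p : PMF α) (g : α → PMF β) (f : β → ℝ≥0∞) :
    eexp (p.bind g) f = eexp p fun a => eexp (g a) f := by
  simp only [eexp, PMF.bind_apply, ← ENNReal.tsum_mul_right, ← ENNReal.tsum_mul_left]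
  rw [ENNReal.tsum_comm]
  simp only [mul_assoc]

theorem eexp_pure (a : α) (f : α → ℝ≥0∞) : eexp (PMF.pure a) f = f a := by
  classical
  rw [eexp, tsum_eq_single a]
  · simp
  · intro b hb
    simp [PMF.pure_apply, hb]

theorem eexp_map (p : PMF α) (g : α → β) (f : β → ℝ≥0∞) :
    eexp (p.map g) f = eexp p fun a => f (g a) := by
  rw [PMF.map, eexp_bind]
  simp [eexp_pure]

theorem eexp_const (p : PMF α) (c : ℝ≥0∞) : eexp p (fun _ => c) = c := by
  simp [eexp, ENNReal.tsum_mul_right, p.tsum_coe]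

theorem eexp_mono_support (p : PMF α) {f g : α → ℝ≥0∞} (h : ∀ a ∈ p.support, f a ≤ g a) :
    eexp p f ≤ eexp p g := by
  refine ENNReal.tsum_le_tsum fun a => ?_
  by_cases ha : p a = 0
  · simp [ha]
  · gcongr
    exact h a ((PMF.mem_support_iff _ _).2 ha)

theorem eexp_mono (p : PMF α) {f g : α → ℝ≥0∞} (h : ∀ a, f a ≤ g a) : eexp p f ≤ eexp p g :=
  eexp_mono_support p fun a _ => h a

theorem eexp_congr_support (p : PMF α) {f g : α → ℝ≥0∞} (h : ∀ a ∈ p.support, f a = g a) :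
    eexp p f = eexp p g :=
  le_antisymm (eexp_mono_support p fun a ha => (h a ha).le)
    (eexp_mono_support p fun a ha => (h a ha).ge)

theorem eexp_add (p : PMF α) (f g : α → ℝ≥0∞) :
    eexp p (fun a => f a + g a) = eexp p f + eexp p g := by
  simp [eexp, mul_add, ENNReal.tsum_add]

theorem eexp_const_mul (p : PMF α) (c : ℝ≥0∞) (f : α → ℝ≥0∞) :
    eexp p (fun a => c * f a) = c * eexp p f := by
  simp only [eexp, ← ENNReal.tsum_mul_left]
  exact tsum_congr fun a => by ring

theorem eexp_mul_const (p : PMF α) (c : ℝ≥0∞) (f : α → ℝ≥0∞) :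
    eexp p (fun a => f a * c) = eexp p f * c := by
  simp only [mul_comm _ c, eexp_const_mul]

theorem eexp_sum {ι : Type*} (p : PMF α) (s : Finset ι) (f : ι → α → ℝ≥0∞) :
    eexp p (fun a => ∑ i ∈ s, f i a) = ∑ i ∈ s, eexp p (f i) := by
  classical
  induction s using Finset.induction_on with
  | empty => simp [eexp_const]
  | insert i s hi ih => simp only [Finset.sum_insert hi, eexp_add, ih]

theorem eexp_comm (p : PMF α) (q : PMF β) (f : α → β → ℝ≥0∞) :
    eexp p (fun a => eexp q fun b => f a b) = eexp q fun b => eexp p fun a => f a b := by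
  simp only [eexp, ← ENNReal.tsum_mul_left]
  rw [ENNReal.tsum_comm]
  exact tsum_congr fun b => tsum_congr fun a => by ring

theorem eexp_fintype [Fintype α] (p : PMF α) (f : α → ℝ≥0∞) : eexp p f = ∑ a, p a * f a :=
  tsum_fintype _

theorem eexp_uniform [Fintype α] [Nonempty α] (f : α → ℝ≥0∞) :
    eexp (PMF.uniformOfFintype α) f = (Fintype.card α : ℝ≥0∞)⁻¹ * ∑ a, f a := by
  simp [eexp_fintype, Finset.mul_sum]

theorem eexp_indicator (p : PMF α) (E : Set α) :
    eexp p (E.indicator 1) = p.toOuterMeasure E := by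
  rw [PMF.toOuterMeasure_apply, eexp]
  refine tsum_congr fun a => ?_
  by_cases h : a ∈ E <;> simp [h]

theorem eexp_indicator_singleton (p : PMF α) (a : α) :
    eexp p (({a} : Set α).indicator 1) = p a := by
  rw [eexp_indicator, PMF.toOuterMeasure_apply_singleton]

theorem eexp_indicator_le_one (p : PMF α) (E : Set α) : eexp p (E.indicator 1) ≤ 1 := by
  refine (eexp_mono p fun a => ?_).trans (eexp_const p 1).le
  exact Set.indicator_le_self' (by simp) a

theorem eexp_indicator_ne_top (p : PMF α) (E : Set α) : eexp p (E.indicator 1) ≠ ⊤ :=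
  ne_top_of_le_ne_top ENNReal.one_ne_top (eexp_indicator_le_one p E)

theorem eexp_indicator_add_compl (p : PMF α) (E : Set α) :
    eexp p (E.indicator 1) + eexp p (Eᶜ.indicator 1) = 1 := by
  rw [← eexp_add, ← eexp_const p 1]
  refine eexp_congr_support p fun a _ => ?_
  by_cases h : a ∈ E <;> simp [h]

theorem prob_eq_eexp (p : PMF α) (E : Set α) : prob p E = (eexp p (E.indicator 1)).toReal := by
  rw [prob, eexp_indicator]

theorem ofReal_prob (p : PMF α) (E : Set α) :
    ENNReal.ofReal (prob p E) = eexp p (E.indicator 1) := by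
  rw [prob_eq_eexp, ENNReal.ofReal_toReal (eexp_indicator_ne_top p E)]

theorem prob_nonneg (p : PMF α) (E : Set α) : 0 ≤ prob p E := ENNReal.toReal_nonneg

theorem prob_le_one (p : PMF α) (E : Set α) : prob p E ≤ 1 := by
  rw [prob_eq_eexp]
  exact ENNReal.toReal_le_of_le_ofReal zero_le_one (by simpa using eexp_indicator_le_one p E)

theorem prob_add_compl (p : PMF α) (E : Set α) : prob p E + prob p Eᶜ = 1 := by
  rw [prob_eq_eexp, prob_eq_eexp, ← ENNReal.toReal_add (eexp_indicator_ne_top _ _)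
    (eexp_indicator_ne_top _ _), eexp_indicator_add_compl, ENNReal.toReal_one]

theorem prob_mono_support (p : PMF α) {E F : Set α} (h : ∀ a ∈ p.support, a ∈ E → a ∈ F) :
    prob p E ≤ prob p F := by
  rw [prob_eq_eexp, prob_eq_eexp]
  refine ENNReal.toReal_mono (eexp_indicator_ne_top _ _) (eexp_mono_support p fun a ha => ?_)
  by_cases hE : a ∈ E
  · simp [hE, h a ha hE]
  · simp [hE]

theorem one_le_prob_of_forall_support (p : PMF α) {E : Set α} (h : ∀ a ∈ p.support, a ∈ E) :
    1 ≤ prob p E := by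
  have h1 : prob p Set.univ = 1 := by
    have := prob_add_compl p Set.univ
    simpa [prob_eq_eexp p ∅, eexp_const, Pi.zero_def] using this
  rw [← h1]
  exact prob_mono_support p fun a ha _ => h a ha

theorem expect_eq_eexp (p : PMF α) {f : α → ℝ} (hf : ∀ a ∈ p.support, 0 ≤ f a) :
    expect p f = (eexp p fun a => ENNReal.ofReal (f a)).toReal := by
  rw [expect, eexp, ENNReal.tsum_toReal_eq]
  · refine tsum_congr fun a => ?_
    by_cases ha : p a = 0
    · simp [ha]
    · rw [ENNReal.toReal_mul, ENNReal.toReal_ofReal (hf a ((PMF.mem_support_iff _ _).2 ha))]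
  · exact fun a => ENNReal.mul_ne_top (p.apply_ne_top a) ENNReal.ofReal_ne_top

/-- The expectation of a product over independent samples factorizes. -/
theorem eexp_iid_prod (p : PMF α) (f : α → ℝ≥0∞) (m : ℕ) :
    eexp (iid p m) (fun v => ∏ i, f (v i)) = eexp p f ^ m := by
  induction m with
  | zero => simp [iid, eexp_pure]
  | succ m ih =>
    rw [iid, eexp_bind]
    simp only [eexp_map, Fin.prod_univ_succ, Fin.cons_zero, Fin.cons_succ, eexp_const_mul, ih,
      eexp_mul_const]
    ring

end Expectation

end VideoRL

/-! ### Resampling of frames under noise-free policies. -/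

namespace VideoRL

open scoped ENNReal

section Resampling

variable {X S A : Type*}

/-- Redrawing one observation of a video from the emission law of its latent state leaves the
video law unchanged, provided actions depend on observations only through latent states. -/
theorem eexp_videoFrom_resample (M : BlockMDP X S A) (π : ℕ → X → PMF A) {L h : ℕ} {s : S}
    (hπ : ∀ i : Fin L, ∀ v ∈ (M.videoFrom π L h s).support,
      ∀ w ∈ (M.videoFrom π L h s).support, M.decode (v i) = M.decode (w i) →
        π (h + i) (v i) = π (h + i) (w i))
    (i : Fin L) (G : (Fin L → X) → ℝ≥0∞) :
    eexp (M.videoFrom π L h s) G =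
      eexp (M.videoFrom π L h s)
        fun v => eexp (M.emit (M.decode (v i))) fun y => G (Function.update v i y) := by
  induction L generalizing h s with
  | zero => exact i.elim0
  | succ L ih =>
    have hmem : ∀ {x a s' v}, x ∈ (M.emit s).support → a ∈ (π h x).support →
        s' ∈ (M.trans s a).support → v ∈ (M.videoFrom π L (h + 1) s').support →
        (Fin.cons x v : Fin (L + 1) → X) ∈ (M.videoFrom π (L + 1) h s).support := by
      intro x a s' v hx ha hs hv
      simp only [BlockMDP.videoFrom, PMF.mem_support_bind_iff, PMF.mem_support_map_iff]
      exact ⟨x, hx, a, ha, s', hs, v, hv, rfl⟩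
    simp only [BlockMDP.videoFrom, eexp_bind, eexp_map]
    refine Fin.cases ?_ (fun j => ?_) i
    · simp only [Fin.cons_zero, Fin.update_cons_zero]
      -- The action at the first frame was drawn from `π h x`, but the redrawn frame is `y`.
      -- Noise-freeness identifies `π h x` with `π h y`, after which the original `x` no longer
      -- occurs and averages out.
      have hswap : ∀ x ∈ (M.emit s).support,
          (eexp (π h x) fun a => eexp (M.trans s a) fun s' =>
            eexp (M.videoFrom π L (h + 1) s') fun v =>
              eexp (M.emit (M.decode x)) fun y => G (Fin.cons y v)) =
          eexp (M.emit s) fun y => eexp (π h y) fun a => eexp (M.trans s a) fun s' =>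
            eexp (M.videoFrom π L (h + 1) s') fun v => G (Fin.cons y v) := by
        intro x hx
        rw [M.decode_emit s x hx]
        simp only [eexp_comm _ (M.emit s)]
        refine eexp_congr_support _ fun y hy => ?_
        -- Noise-freeness compares whole videos in the support, so single observations are first
        -- extended to such videos.
        have hex : ∀ z ∈ (M.emit s).support,
            ∃ w ∈ (M.videoFrom π (L + 1) h s).support, w 0 = z := by
          intro z hz
          obtain ⟨a, ha⟩ := (π h z).support_nonempty
          obtain ⟨s', hs'⟩ := (M.trans s a).support_nonempty
          obtain ⟨v, hv⟩ := (M.videoFrom π L (h + 1) s').support_nonempty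
          exact ⟨_, hmem hz ha hs' hv, Fin.cons_zero _ _⟩
        obtain ⟨w₁, hw₁, rfl⟩ := hex x hx
        obtain ⟨w₂, hw₂, rfl⟩ := hex y hy
        have := hπ 0 w₁ hw₁ w₂ hw₂ (by rw [M.decode_emit s _ hx, M.decode_emit s _ hy])
        simp only [Fin.val_zero, add_zero] at this
        rw [this]
      rw [eexp_congr_support _ hswap, eexp_const]
    · simp only [Fin.cons_succ]
      refine eexp_congr_support _ fun x hx => eexp_congr_support _ fun a ha =>
        eexp_congr_support _ fun s' hs' => ?_
      rw [ih (h := h + 1) (s := s') _ j (fun v => G (Fin.cons x v))]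
      · simp only [Fin.cons_update]
      · intro i' v hv w hw hvw
        have := hπ i'.succ _ (hmem hx ha hs' hv) _ (hmem hx ha hs' hw) (by simpa using hvw)
        simpa [Fin.cons_succ, add_assoc, add_comm 1] using this

end Resampling

namespace VideoProcess

variable {X S A : Type*} {H K : ℕ}

theorem eexp_video_resample {P : VideoProcess X S A H K} (hP : P.NoiseFree)
    (i : Fin (H + K)) (G : (Fin (H + K) → X) → ℝ≥0∞) :
    eexp P.video G = eexp P.video
      fun v => eexp (P.env.emit (P.env.decode (v i))) fun y => G (Function.update v i y) := by
  simp only [video, BlockMDP.video, eexp_bind]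
  refine eexp_congr_support _ fun π hπ => eexp_congr_support _ fun s hs => ?_
  refine eexp_videoFrom_resample _ _ (fun j v hv w hw hvw => ?_) i G
  rw [zero_add]
  refine hP π hπ j v ?_ w ?_ hvw <;>
  · simp only [BlockMDP.video, PMF.mem_support_bind_iff]
    exact ⟨s, hs, by assumption⟩

/-! ### Law of a contrastive data point and the Bayes classifier. -/

variable [NeZero H] (P : VideoProcess X S A H K)

theorem eexp_rho (F : X → ℝ≥0∞) :
    eexp P.rho F = eexp P.video fun v =>
      eexp (PMF.uniformOfFintype (Fin H)) fun h => F (v (Fin.castAdd K h)) := by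
  simp only [rho, eexp_bind, eexp_map]

theorem eexp_pair (k : Fin K) (F : X × X → ℝ≥0∞) :
    eexp (P.pair k) F = eexp P.video fun v =>
      eexp (PMF.uniformOfFintype (Fin H)) fun h => F (v (Fin.castAdd K h), v (later h k)) := by
  simp only [pair, eexp_bind, eexp_map]

theorem eexp_pair_fst (k : Fin K) (F : X → ℝ≥0∞) :
    eexp (P.pair k) (fun p => F p.1) = eexp P.rho F := by
  rw [eexp_pair, eexp_rho]

/-- A contrastive data point is, with equal probabilities, a pair of observations of one video or
a pair of independent observations. -/
theorem eexp_cont (F : X × Fin K × X × Bool → ℝ≥0∞) :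
    eexp P.cont F =
      2⁻¹ * eexp P.lag (fun k => eexp (P.pair k) fun p => F (p.1, k, p.2, true)) +
      2⁻¹ * eexp P.rho (fun x => eexp P.lag fun k => eexp P.rho fun x' => F (x, k, x', false)) := by
  simp only [cont, eexp_bind, eexp_map]
  have hb : ∀ f : Bool → ℝ≥0∞,
      eexp (PMF.uniformOfFintype Bool) f = 2⁻¹ * f true + 2⁻¹ * f false := by
    intro f
    rw [eexp_uniform]
    simp [mul_add]
  simp only [hb, eexp_add, eexp_const_mul, if_true, eexp_const, Bool.false_eq_true, if_false,
    eexp_pair, eexp_rho]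
  congr 2
  · rw [eexp_comm]
  · refine eexp_congr_support _ fun v _ => ?_
    simp only [eexp_comm P.video]
    simp only [eexp_comm P.lag]

theorem eexp_coup (F : X × X × Fin K × X → ℝ≥0∞) :
    eexp P.coup F = eexp P.rho fun x₁ => eexp P.rho fun x₂ => eexp P.lag fun k =>
      eexp P.rho fun x' => F (x₁, x₂, k, x') := by
  simp only [coup, eexp_bind, eexp_map]

theorem eexp_twoRho (F : X × X → ℝ≥0∞) :
    eexp P.twoRho F = eexp P.rho fun x₁ => eexp P.rho fun x₂ => F (x₁, x₂) := by
  simp only [twoRho, eexp_bind, eexp_map]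

theorem cont_true (x : X) (k : Fin K) (x' : X) :
    P.cont (x, k, x', true) = 2⁻¹ * (P.lag k * P.pair k (x, x')) := by
  classical
  rw [← eexp_indicator_singleton, eexp_cont, ← eexp_indicator_singleton (P.pair k)]
  have h1 : (eexp P.rho fun y => eexp P.lag fun l => eexp P.rho fun y' =>
      (({(x, k, x', true)} : Set (X × Fin K × X × Bool)).indicator 1 (y, l, y', false) : ℝ≥0∞))
      = 0 := by
    simp [Set.indicator, eexp_const]
  rw [h1, mul_zero, add_zero]
  congr 1
  rw [eexp, tsum_eq_single k]
  · congr 2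
    funext p
    simp [Set.indicator, Prod.ext_iff]
  · intro l hl
    simp [Set.indicator, hl, eexp_const]

theorem cont_false (x : X) (k : Fin K) (x' : X) :
    P.cont (x, k, x', false) = 2⁻¹ * (P.lag k * (P.rho x * P.rho x')) := by
  classical
  rw [← eexp_indicator_singleton, eexp_cont]
  have h1 : (eexp P.lag fun l => eexp (P.pair l) fun p =>
      (({(x, k, x', false)} : Set (X × Fin K × X × Bool)).indicator 1 (p.1, l, p.2, true) : ℝ≥0∞))
      = 0 := by
    simp [Set.indicator, eexp_const]
  rw [h1, mul_zero, zero_add]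
  congr 1
  rw [eexp, tsum_eq_single x, eexp, tsum_eq_single k, eexp, tsum_eq_single x']
  · simp [Set.indicator]
    ring
  · intro y hy
    simp [Set.indicator, hy]
  · intro l hl
    simp [Set.indicator, hl, eexp_const]
  · intro y hy
    simp [Set.indicator, hy, eexp_const]

/-- Law of the latent states of a pair of observations at lag `k`. -/
noncomputable def pairState (k : Fin K) (s s' : S) : ℝ :=
  prob (P.pair k) {p | P.env.decode p.1 = s ∧ P.env.decode p.2 = s'}

theorem pairState_nonneg (k : Fin K) (s s' : S) : 0 ≤ P.pairState k s s' := prob_nonneg _ _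

theorem rhoState_nonneg (s : S) : 0 ≤ P.rhoState s := prob_nonneg _ _

theorem prob_pair_fst (k : Fin K) (s : S) :
    prob (P.pair k) {p | P.env.decode p.1 = s} = P.rhoState s := by
  rw [rhoState, prob_eq_eexp, prob_eq_eexp, ← eexp_pair_fst P k]
  rfl

theorem stateStep_eq (s : S) (k : Fin K) (s' : S) :
    P.stateStep s k s' = P.pairState k s s' / P.rhoState s := by
  rw [stateStep, prob_pair_fst, pairState]

theorem pairState_le_rhoState (k : Fin K) (s s' : S) : P.pairState k s s' ≤ P.rhoState s := by
  rw [← prob_pair_fst P k]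
  exact prob_mono_support _ fun p _ hp => hp.1

variable {P}

/-- Resample frame `h`: it equals `x` exactly when its latent state is that of `x` and the fresh
emission hits `x`, by disjointness of the supports. -/
theorem rho_apply (hP : P.NoiseFree) (x : X) :
    (P.rho x).toReal =
      (P.env.emit (P.env.decode x) x).toReal * P.rhoState (P.env.decode x) := by
  classical
  rw [rhoState, prob_eq_eexp, ← ENNReal.toReal_mul, ← eexp_const_mul,
    ← eexp_indicator_singleton, eexp_rho, eexp_rho, eexp_comm, eexp_comm P.video]
  congr 1
  refine eexp_congr_support _ fun h _ => ?_
  rw [eexp_video_resample hP (Fin.castAdd K h)]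
  refine eexp_congr_support _ fun v _ => ?_
  simp only [Function.update_self, eexp_indicator_singleton]
  by_cases hv : P.env.decode (v (Fin.castAdd K h)) = P.env.decode x
  · simp [hv]
  · have : x ∉ (P.env.emit (P.env.decode (v (Fin.castAdd K h)))).support :=
      fun hx => hv (P.env.decode_emit _ _ hx).symm
    simp [Set.indicator, hv, (PMF.apply_eq_zero_iff _ _).2 this]

omit [NeZero H] in
theorem later_ne_castAdd (h : Fin H) (k : Fin K) : later h k ≠ Fin.castAdd K h := by
  intro he
  have := congrArg Fin.val he
  simp [later] at this
  omega

theorem pair_apply (hP : P.NoiseFree) (k : Fin K) (x x' : X) :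
    (P.pair k (x, x')).toReal =
      (P.env.emit (P.env.decode x) x).toReal * (P.env.emit (P.env.decode x') x').toReal *
        P.pairState k (P.env.decode x) (P.env.decode x') := by
  classical
  have hemit : ∀ y s, P.env.emit s y = if s = P.env.decode y then
      P.env.emit (P.env.decode y) y else 0 := by
    intro y s
    split_ifs with hs
    · rw [hs]
    · exact (PMF.apply_eq_zero_iff _ _).2 fun hy => hs (P.env.decode_emit _ _ hy).symm
  rw [pairState, prob_eq_eexp, ← ENNReal.toReal_mul, ← ENNReal.toReal_mul, ← eexp_const_mul,
    ← eexp_indicator_singleton, eexp_pair, eexp_pair, eexp_comm, eexp_comm P.video]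
  congr 1
  refine eexp_congr_support _ fun h _ => ?_
  -- The later frame is redrawn first and the earlier one afterwards. The lag is at least 1, so the
  -- two positions differ and neither redraw touches the other frame.
  rw [eexp_video_resample hP (later h k)]
  have h1 : ∀ v : Fin (H + K) → X,
      (eexp (P.env.emit (P.env.decode (v (later h k)))) fun y =>
        (({(x, x')} : Set (X × X)).indicator 1
          (Function.update v (later h k) y (Fin.castAdd K h),
            Function.update v (later h k) y (later h k)) : ℝ≥0∞)) =
      (({x} : Set X).indicator 1 (v (Fin.castAdd K h)) : ℝ≥0∞) *
        P.env.emit (P.env.decode (v (later h k))) x' := by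
    intro v
    rw [← eexp_indicator_singleton (P.env.emit _) x', ← eexp_const_mul]
    refine eexp_congr_support _ fun y _ => ?_
    rw [Function.update_self, Function.update_of_ne (later_ne_castAdd h k).symm]
    by_cases hx : v (Fin.castAdd K h) = x <;> by_cases hy : y = x' <;>
      simp [Set.indicator, hx, hy]
  simp only [h1]
  rw [eexp_video_resample hP (Fin.castAdd K h)]
  refine eexp_congr_support _ fun v _ => ?_
  simp only [Function.update_self, Function.update_of_ne (later_ne_castAdd h k), eexp_mul_const,
    eexp_indicator_singleton]
  rw [hemit x, hemit x']
  by_cases hx : P.env.decode (v (Fin.castAdd K h)) = P.env.decode x <;>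
    by_cases hy : P.env.decode (v (later h k)) = P.env.decode x' <;>
      simp [Set.indicator, hx, hy]

theorem prob_cont_true (s : S) (k : Fin K) (s' : S) :
    prob P.cont {t | P.env.decode t.1 = s ∧ t.2.1 = k ∧ P.env.decode t.2.2.1 = s' ∧
      t.2.2.2 = true} = 2⁻¹ * ((P.lag k).toReal * P.pairState k s s') := by
  classical
  rw [pairState, prob_eq_eexp, prob_eq_eexp, ← ENNReal.toReal_mul, eexp_cont]
  rw [show (2 : ℝ)⁻¹ = (2⁻¹ : ℝ≥0∞).toReal by simp, ← ENNReal.toReal_mul]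
  congr 1
  have h1 : (eexp P.rho fun y => eexp P.lag fun l => eexp P.rho fun y' =>
      (({t | P.env.decode t.1 = s ∧ t.2.1 = k ∧ P.env.decode t.2.2.1 = s' ∧
      t.2.2.2 = true} : Set (X × Fin K × X × Bool)).indicator 1 (y, l, y', false) : ℝ≥0∞))
      = 0 := by
    simp [Set.indicator, eexp_const]
  rw [h1, mul_zero, add_zero]
  congr 1
  rw [eexp, tsum_eq_single k]
  · congr 2
    funext p
    simp [Set.indicator]
  · intro l hl
    simp [Set.indicator, hl, eexp_const]

theorem prob_cont_false (s : S) (k : Fin K) (s' : S) :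
    prob P.cont {t | P.env.decode t.1 = s ∧ t.2.1 = k ∧ P.env.decode t.2.2.1 = s' ∧
      t.2.2.2 = false} = 2⁻¹ * ((P.lag k).toReal * (P.rhoState s * P.rhoState s')) := by
  classical
  rw [rhoState, rhoState, prob_eq_eexp, prob_eq_eexp, prob_eq_eexp, ← ENNReal.toReal_mul,
    ← ENNReal.toReal_mul, eexp_cont]
  rw [show (2 : ℝ)⁻¹ = (2⁻¹ : ℝ≥0∞).toReal by simp, ← ENNReal.toReal_mul]
  congr 1
  have h1 : (eexp P.lag fun l => eexp (P.pair l) fun p =>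
      (({t | P.env.decode t.1 = s ∧ t.2.1 = k ∧ P.env.decode t.2.2.1 = s' ∧
      t.2.2.2 = false} : Set (X × Fin K × X × Bool)).indicator 1 (p.1, l, p.2, true) : ℝ≥0∞))
      = 0 := by
    simp [Set.indicator, eexp_const]
  rw [h1, mul_zero, zero_add]
  congr 1
  rw [eexp_comm, eexp, tsum_eq_single k]
  · rw [← eexp_mul_const]
    congr 1
    refine eexp_congr_support _ fun x _ => ?_
    rw [← eexp_const_mul]
    refine eexp_congr_support _ fun x' _ => ?_
    by_cases hx : P.env.decode x = s <;> by_cases hy : P.env.decode x' = s' <;>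
      simp [Set.indicator, hx, hy]
  · intro l hl
    simp [Set.indicator, hl, eexp_const]

theorem prob_cont_eq_add (s : S) (k : Fin K) (s' : S) :
    prob P.cont {t | P.env.decode t.1 = s ∧ t.2.1 = k ∧ P.env.decode t.2.2.1 = s'} =
      prob P.cont {t | P.env.decode t.1 = s ∧ t.2.1 = k ∧ P.env.decode t.2.2.1 = s' ∧
        t.2.2.2 = true} +
      prob P.cont {t | P.env.decode t.1 = s ∧ t.2.1 = k ∧ P.env.decode t.2.2.1 = s' ∧
        t.2.2.2 = false} := by
  classical
  simp only [prob_eq_eexp]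
  rw [← ENNReal.toReal_add (eexp_indicator_ne_top _ _) (eexp_indicator_ne_top _ _), ← eexp_add]
  congr 1
  refine eexp_congr_support _ fun t _ => ?_
  obtain ⟨x, l, x', z⟩ := t
  cases z <;> simp [Set.indicator]

theorem bayesState_eq {k : Fin K} (hk : k ∈ P.lag.support) (s s' : S) :
    P.bayesState s k s' =
      P.pairState k s s' / (P.pairState k s s' + P.rhoState s * P.rhoState s') := by
  have hk' : (P.lag k).toReal ≠ 0 :=
    (ENNReal.toReal_pos ((PMF.mem_support_iff _ _).1 hk) (P.lag.apply_ne_top k)).ne'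
  rw [bayesState, prob_cont_eq_add, prob_cont_true, prob_cont_false, ← mul_add, ← mul_add,
    ← mul_assoc, ← mul_assoc, mul_div_mul_left]
  positivity

/-- Positive and negative masses share the factor `ω(k) q(x ∣ s) q(x' ∣ s') / 2`, which is nonzero
on the support and cancels. -/
theorem bayes_eq (hP : P.NoiseFree) {x : X} {k : Fin K} {x' : X} (h : P.InSupport x k x') :
    k ∈ P.lag.support ∧ P.rhoState (P.env.decode x) ≠ 0 ∧
    P.bayes x k x' = P.bayesState (P.env.decode x) k (P.env.decode x') := by
  have e1 := pair_apply hP k x x'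
  have e2 := rho_apply hP x
  have e3 := rho_apply hP x'
  have ht : (P.cont (x, k, x', true)).toReal =
      2⁻¹ * ((P.lag k).toReal * (P.pair k (x, x')).toReal) := by
    simp [cont_true]
  have hf : (P.cont (x, k, x', false)).toReal =
      2⁻¹ * ((P.lag k).toReal * ((P.rho x).toReal * (P.rho x').toReal)) := by
    simp [cont_false]
  rw [e1] at ht
  rw [e2, e3] at hf
  have hne : (P.lag k).toReal ≠ 0 ∧ P.rhoState (P.env.decode x) ≠ 0 ∧
      (P.env.emit (P.env.decode x) x).toReal ≠ 0 ∧
      (P.env.emit (P.env.decode x') x').toReal ≠ 0 := by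
    obtain ⟨z, hz⟩ := h
    have hz' : (P.cont (x, k, x', z)).toReal ≠ 0 :=
      (ENNReal.toReal_pos ((PMF.mem_support_iff _ _).1 hz) (PMF.apply_ne_top _ _)).ne'
    cases z
    · rw [hf] at hz'
      refine ⟨fun h0 => hz' ?_, fun h0 => hz' ?_, fun h0 => hz' ?_, fun h0 => hz' ?_⟩ <;>
        simp [h0]
    -- A positive example contains no factor `ρ(s)`; that it is nonzero follows because the joint
    -- law is dominated by its first marginal.
    · have hle := P.pairState_le_rhoState k (P.env.decode x) (P.env.decode x')
      have h0le := P.pairState_nonneg k (P.env.decode x) (P.env.decode x')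
      rw [ht] at hz'
      refine ⟨fun h0 => hz' ?_, fun h0 => hz' ?_, fun h0 => hz' ?_, fun h0 => hz' ?_⟩
      · simp [h0]
      · rw [h0] at hle
        simp [le_antisymm hle h0le]
      · simp [h0]
      · simp [h0]
  obtain ⟨h1, h2, h3, h4⟩ := hne
  have hk : k ∈ P.lag.support := fun h0 => h1 (by simp [h0])
  refine ⟨hk, h2, ?_⟩
  rw [bayesState_eq hk, bayes, ht, hf]
  set a := 2⁻¹ * ((P.lag k).toReal * ((P.env.emit (P.env.decode x) x).toReal *
    (P.env.emit (P.env.decode x') x').toReal)) with ha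
  have ha0 : a ≠ 0 := by
    rw [ha]
    positivity
  rw [← mul_div_mul_left (P.pairState k (P.env.decode x) (P.env.decode x')) _ ha0]
  congr 1
  · rw [ha]; ring
  · rw [ha]; ring

theorem bayes_eq_stateStep (hP : P.NoiseFree) {x : X} {k : Fin K} {x' : X}
    (h : P.InSupport x k x') :
    P.bayes x k x' =
      P.stateStep (P.env.decode x) k (P.env.decode x') /
        (P.stateStep (P.env.decode x) k (P.env.decode x') + P.rhoState (P.env.decode x')) := by
  obtain ⟨hk, hρ, he⟩ := bayes_eq hP h
  rw [he, bayesState_eq hk, stateStep_eq, ← mul_div_mul_left (_ / _) _ hρ, mul_add,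
    mul_div_cancel₀ _ hρ]

/-- Negative examples have full support in the product of `ρ`, `ω` and `ρ`, so realizability applies
to all triples met by the coupling distribution. -/
theorem inSupport_of_rho {x : X} {k : Fin K} {x' : X} (hx : x ∈ P.rho.support)
    (hk : k ∈ P.lag.support) (hx' : x' ∈ P.rho.support) : P.InSupport x k x' := by
  refine ⟨false, ?_⟩
  rw [PMF.mem_support_iff] at *
  rw [cont_false]
  simp [hx, hk, hx']

end VideoProcess

end VideoRL

/-! ### Exponential moment of the excess square loss. -/

namespace VideoRL

/-- Hoeffding's lemma for a Bernoulli variable. -/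
theorem bernoulli_mgf_le {p : ℝ} (hp0 : 0 ≤ p) (hp1 : p ≤ 1) (t : ℝ) :
    (1 - p) + p * Real.exp t ≤ Real.exp (p * t + t ^ 2 / 8) := by
  open MeasureTheory ProbabilityTheory in
  set μ : Measure ℝ := ENNReal.ofReal (1 - p) • Measure.dirac 0 + ENNReal.ofReal p • Measure.dirac 1
    with hμ
  have hprob : IsProbabilityMeasure μ := ⟨by
    simp [hμ, ← ENNReal.ofReal_add (sub_nonneg.2 hp1) hp0]⟩
  have hint : ∀ f : ℝ → ℝ, ∫ x, f x ∂μ = (1 - p) * f 0 + p * f 1 := by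
    intro f
    rw [hμ, integral_add_measure, integral_smul_measure, integral_smul_measure, integral_dirac,
      integral_dirac, ENNReal.toReal_ofReal (sub_nonneg.2 hp1), ENNReal.toReal_ofReal hp0]
    · rfl
    · exact (integrable_dirac (by simp)).smul_measure ENNReal.ofReal_ne_top
    · exact (integrable_dirac (by simp)).smul_measure ENNReal.ofReal_ne_top
  have hsub := hasSubgaussianMGF_of_mem_Icc (μ := μ) (X := fun x => x) (a := 0) (b := 1)
    aemeasurable_id (by
      rw [hμ, ae_add_measure_iff]
      constructor <;>
      · refine Measure.ae_smul_measure ?_ _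
        refine (ae_dirac_iff measurableSet_Icc).2 ?_
        norm_num)
  have h := hsub.mgf_le t
  rw [mgf, hint, hint] at h
  have e : (1 - p) + p * Real.exp t = Real.exp (p * t) *
      ((1 - p) * Real.exp (t * (0 - ((1 - p) * 0 + p * 1))) +
        p * Real.exp (t * (1 - ((1 - p) * 0 + p * 1)))) := by
    have e1 : Real.exp (p * t) * Real.exp (t * (0 - ((1 - p) * 0 + p * 1))) = 1 := by
      rw [← Real.exp_add]
      ring_nf
      exact Real.exp_zero
    have e2 : Real.exp (p * t) * Real.exp (t * (1 - ((1 - p) * 0 + p * 1))) = Real.exp t := by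
      rw [← Real.exp_add]
      congr 1
      ring
    linear_combination (-(1 - p)) * e1 - p * e2
  rw [e, Real.exp_add]
  gcongr
  refine h.trans (Real.exp_le_exp.2 (le_of_eq ?_))
  simp
  ring

/-- The right side times `1 + y + y ^ 2 / 2 ≤ exp y` is `1 + y ^ 4 / 4`. -/
theorem exp_neg_le {y : ℝ} (hy : 0 ≤ y) : Real.exp (-y) ≤ 1 - y + y ^ 2 / 2 := by
  have h1 := Real.quadratic_le_exp_of_nonneg hy
  rw [Real.exp_neg]
  rw [inv_le_iff_one_le_mul₀ (Real.exp_pos _)]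
  have h2 : 0 ≤ 1 - y + y ^ 2 / 2 := by nlinarith [sq_nonneg (y - 1)]
  calc 1 ≤ (1 - y + y ^ 2 / 2) * (1 + y + y ^ 2 / 2) := by nlinarith [sq_nonneg (y ^ 2)]
    _ ≤ _ := by gcongr

theorem exp_two_mul_sub_le {d : ℝ} (h1 : |d| ≤ 1) :
    Real.exp (2 * d) - 1 - 2 * d ≤ |d| ^ 2 * (2 + 12 / 5 * |d|) := by
  have key : ∀ u : ℝ, 0 ≤ u → u ≤ 1 →
      Real.exp (2 * u) - 1 - 2 * u ≤ u ^ 2 * (2 + 12 / 5 * u) := by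
    intro u hu0 hu1
    have he := Real.exp_bound' hu0 hu1 (n := 4) (by norm_num)
    simp [Finset.sum_range_succ, Nat.factorial] at he
    -- `Real.exp_bound'` only reaches arguments up to 1, hence the square of the bound at `u`.
    rw [show 2 * u = u + u by ring, Real.exp_add]
    have hsq := mul_le_mul he he (Real.exp_pos u).le (le_trans (Real.exp_pos u).le he)
    refine le_trans (sub_le_sub_right (sub_le_sub_right hsq _) _) ?_
    have p3 : 0 ≤ u ^ 3 := by positivity
    have p4 : u ^ 4 ≤ u ^ 3 := pow_le_pow_of_le_one hu0 hu1 (by norm_num)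
    have p5 : u ^ 5 ≤ u ^ 3 := pow_le_pow_of_le_one hu0 hu1 (by norm_num)
    have p6 : u ^ 6 ≤ u ^ 3 := pow_le_pow_of_le_one hu0 hu1 (by norm_num)
    have p7 : u ^ 7 ≤ u ^ 3 := pow_le_pow_of_le_one hu0 hu1 (by norm_num)
    have p8 : u ^ 8 ≤ u ^ 3 := pow_le_pow_of_le_one hu0 hu1 (by norm_num)
    ring_nf
    linarith
  rcases le_total 0 d with hd | hd
  · rw [abs_of_nonneg hd] at *
    exact key d hd h1
  · rw [abs_of_nonpos hd] at *
    refine le_trans ?_ (key (-d) (by linarith) h1)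
    -- By `sinh y ≥ y` for `y ≥ 0`, the left side at a negative `d` is at most that at `-d`.
    have hs := Real.self_le_sinh_iff.2 (show 0 ≤ 2 * (-d) by linarith)
    rw [Real.sinh_eq] at hs
    rw [show -(2 * -d) = 2 * d by ring] at hs
    linarith

/-- For `0 ≤ u ≤ 1` a convex minorant of `u ^ 2` above all its tangents at points `e ≤ 1 / 2`, with
bounds for exponentials in terms of it. -/
theorem exists_exp_neg_sq_le {u e : ℝ} (hu0 : 0 ≤ u) (hu1 : u ≤ 1) (he1 : e ≤ 1 / 2) :
    ∃ q, 2 * e * u - e ^ 2 ≤ q ∧ 0 ≤ q ∧ Real.exp (-(u ^ 2 / 2)) ≤ 1 - 23 / 50 * q ∧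
      Real.exp (-u ^ 2) ≤ 1 - 23 / 44 * q ∧
      Real.exp (-(u ^ 2 * (19 / 25 - 36 / 125 * u))) ≤ 1 - 23 / 50 * q := by
  have b1 := exp_neg_le (show 0 ≤ u ^ 2 / 2 by positivity)
  have b2 := exp_neg_le (show 0 ≤ u ^ 2 by positivity)
  have b3 := exp_neg_le (show 0 ≤ u ^ 2 * (19 / 25 - 36 / 125 * u) from
    mul_nonneg (by positivity) (by linarith))
  -- `q` is `u ^ 2` up to `1 / 2` and follows the tangent `u - 1 / 4` from there. With `u ^ 2`
  -- throughout, the bound for `exp (-(u ^ 2 / 2))` would fail at `u = 1`.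
  rcases le_total u (1 / 2) with h | h
  · have hv : 0 ≤ u ^ 2 * (1 / 4 - u ^ 2) := mul_nonneg (sq_nonneg u) (by nlinarith)
    refine ⟨u ^ 2, by nlinarith [sq_nonneg (u - e)], by positivity, b1.trans ?_, b2.trans ?_,
      b3.trans ?_⟩
    · nlinarith [sq_nonneg u]
    · nlinarith [sq_nonneg u]
    · have h2 : (19 / 25 - 36 / 125 * u) ^ 2 ≤ (19 / 25 : ℝ) ^ 2 :=
        pow_le_pow_left₀ (by linarith) (by linarith) _
      have h3 : u ^ 2 * (19 / 25 - 36 / 125 * u) ^ 2 ≤ 1 / 4 * (19 / 25 : ℝ) ^ 2 :=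
        mul_le_mul (by nlinarith) h2 (sq_nonneg _) (by norm_num)
      have h4 : 23 / 50 - (19 / 25 - 36 / 125 * u) +
          u ^ 2 * (19 / 25 - 36 / 125 * u) ^ 2 / 2 ≤ 0 := by linarith
      nlinarith [mul_nonneg (sq_nonneg u) (neg_nonneg.2 h4)]
  · obtain ⟨w, hw⟩ : ∃ w, w = u - 1 / 2 := ⟨_, rfl⟩
    have hw0 : 0 ≤ w := by linarith
    have hw1 : w ≤ 1 / 2 := by linarith
    have hw3 : w ^ 3 ≤ 1 / 2 * w ^ 2 := by nlinarith [sq_nonneg w]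
    have hw4 : w ^ 4 ≤ 1 / 4 * w ^ 2 := by nlinarith [sq_nonneg w]
    refine ⟨u - 1 / 4, by nlinarith, by linarith, b1.trans ?_, ?_, b3.trans ?_⟩
    · rw [show u = w + 1 / 2 by linarith]
      nlinarith [sq_nonneg (w - 18 / 250), hw3, hw4, sq_nonneg w]
    · refine b2.trans ?_
      rw [show u = w + 1 / 2 by linarith]
      nlinarith [hw3, hw4, sq_nonneg w]
    · set D := u ^ 2 * (19 / 25 - 36 / 125 * u) with hD
      have hD0 : 0 ≤ D := mul_nonneg (by positivity) (by linarith)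
      have hD1 : D ≤ 59 / 125 := by
        have : 0 ≤ (1 - u) * (59 / 125 + 59 / 125 * u - 36 / 125 * u ^ 2) :=
          mul_nonneg (by linarith) (by nlinarith)
        rw [hD]
        linarith
      have hD2 : 23 / 50 * (u - 1 / 4) ≤ 191 / 250 * D := by
        have hDw : D = 77 / 500 + 68 / 125 * w + 41 / 125 * w ^ 2 - 36 / 125 * w ^ 3 := by
          rw [hD, hw]
          ring
        have huw : u = w + 1 / 2 := by rw [hw]; ring
        rw [hDw, huw]
        rcases le_total w (1 / 4) with h4 | h4
        · have : w ^ 3 ≤ 1 / 4 * w ^ 2 := by nlinarith [sq_nonneg w]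
          nlinarith [sq_nonneg (w - 113 / 1000)]
        · linarith [hw3, sq_nonneg (w - 1 / 4)]
      linarith [mul_nonneg hD0 (sub_nonneg.2 hD1)]

/-- Exponential moment of the excess square loss of a prediction `f` of a Bernoulli variable with
mean `p`. The linear term on the left serves in place of the quadratic one at `|f - p| ≈ e`. -/
theorem exp_excess_loss_le {p f e : ℝ} (hp0 : 0 ≤ p) (hp1 : p ≤ 1) (hf0 : 0 ≤ f) (hf1 : f ≤ 1)
    (he1 : e ≤ 1 / 2) :
    (1 - p) * Real.exp (p ^ 2 - f ^ 2) + p * Real.exp ((1 - p) ^ 2 - (1 - f) ^ 2) +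
      (1 - p) * (23 / 22 * e * |f - p|) ≤ 1 + (1 - p) * (23 / 44 * e ^ 2) := by
  set u := |f - p| with hu
  have hu0 : 0 ≤ u := abs_nonneg _
  have hu1 : u ≤ 1 := abs_le.2 ⟨by linarith, by linarith⟩
  have hud : u ^ 2 = (f - p) ^ 2 := sq_abs _
  obtain ⟨q, hq, hq0, c1, c2, c3⟩ := exists_exp_neg_sq_le hu0 hu1 he1
  set E := (1 - p) * Real.exp (p ^ 2 - f ^ 2) + p * Real.exp ((1 - p) ^ 2 - (1 - f) ^ 2) with hE
  have hE' : E = Real.exp (p ^ 2 - f ^ 2) * ((1 - p) + p * Real.exp (2 * (f - p))) := by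
    rw [hE, mul_add, mul_left_comm _ p, ← Real.exp_add]
    ring_nf
  suffices h : E ≤ 1 - (1 - p) * (23 / 44 * q) by
    have : (1 - p) * (23 / 44 * (2 * e * u - e ^ 2)) ≤ (1 - p) * (23 / 44 * q) := by
      have : 0 ≤ 1 - p := by linarith
      gcongr
    linarith
  -- The threshold satisfies `(1 - 3 / 25) * (23 / 44) = 23 / 50`. Above it Hoeffding's bound is
  -- enough. Below it the exponent `-u ^ 2 + p * κ` is interpolated by convexity of `exp` between `p
  -- = 0` (bound `c2`) and `p = 3 / 25` (bound `c3`), and the chord is exactly `1 - (1 - p) * (23 /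
  -- 44 * q)`.
  rcases le_total p (3 / 25) with hp | hp
  · set κ := Real.exp (2 * (f - p)) - 1 - 2 * (f - p) with hκ
    have hκ' : κ ≤ u ^ 2 * (2 + 12 / 5 * u) := exp_two_mul_sub_le hu1
    have h1 : E ≤ Real.exp (-u ^ 2 + p * κ) := by
      have := Real.add_one_le_exp (p * (Real.exp (2 * (f - p)) - 1))
      rw [hE']
      calc _ ≤ Real.exp (p ^ 2 - f ^ 2) * Real.exp (p * (Real.exp (2 * (f - p)) - 1)) := by
            gcongr
            linarith
        _ = _ := by
            rw [← Real.exp_add, hud]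
            congr 1
            rw [hκ]
            ring
    have hconv := convexOn_exp.2 (Set.mem_univ (-u ^ 2)) (Set.mem_univ (-u ^ 2 + 3 / 25 * κ))
      (show 0 ≤ 1 - 25 / 3 * p by linarith) (show 0 ≤ 25 / 3 * p by linarith) (by ring)
    simp only [smul_eq_mul] at hconv
    rw [show (1 - 25 / 3 * p) * -u ^ 2 + 25 / 3 * p * (-u ^ 2 + 3 / 25 * κ) = -u ^ 2 + p * κ by
      ring] at hconv
    have h3 : Real.exp (-u ^ 2 + 3 / 25 * κ) ≤ 1 - 23 / 50 * q := by
      refine le_trans (Real.exp_le_exp.2 ?_) c3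
      nlinarith
    have h4 := mul_le_mul_of_nonneg_left c2 (show 0 ≤ 1 - 25 / 3 * p by linarith)
    have h5 := mul_le_mul_of_nonneg_left h3 (show 0 ≤ 25 / 3 * p by linarith)
    nlinarith
  · have h1 : E ≤ Real.exp (-(u ^ 2 / 2)) := by
      have := bernoulli_mgf_le hp0 hp1 (2 * (f - p))
      rw [hE']
      calc _ ≤ Real.exp (p ^ 2 - f ^ 2) *
            Real.exp (p * (2 * (f - p)) + (2 * (f - p)) ^ 2 / 8) := by
            gcongr
        _ = _ := by
            rw [← Real.exp_add, hud]
            congr 1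
            ring
    nlinarith

end VideoRL

/-! ### Empirical risk minimization and the merging gap. -/

namespace VideoRL

open scoped ENNReal

namespace VideoProcess

variable {X S A : Type*} {H K N : ℕ} [NeZero H] {P : VideoProcess X S A H K}

/-- Grouping the mass by `(x, k, x')` leaves two-point inequalities over the label, the shape of
`exp_excess_loss_le`. -/
theorem eexp_cont_le {F F' : X × Fin K × X × Bool → ℝ≥0∞}
    (h : ∀ x k x', P.cont (x, k, x', true) * F (x, k, x', true) +
        P.cont (x, k, x', false) * F (x, k, x', false) ≤
      P.cont (x, k, x', true) * F' (x, k, x', true) +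
        P.cont (x, k, x', false) * F' (x, k, x', false)) :
    eexp P.cont F ≤ eexp P.cont F' := by
  have key : ∀ F : X × Fin K × X × Bool → ℝ≥0∞, eexp P.cont F =
      ∑' x, ∑' k, ∑' x', (P.cont (x, k, x', true) * F (x, k, x', true) +
        P.cont (x, k, x', false) * F (x, k, x', false)) := by
    intro F
    rw [eexp, ENNReal.tsum_prod']
    refine tsum_congr fun x => ?_
    rw [ENNReal.tsum_prod']
    refine tsum_congr fun k => ?_
    rw [ENNReal.tsum_prod']
    refine tsum_congr fun x' => ?_
    rw [tsum_bool, add_comm]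
  rw [key, key]
  exact ENNReal.tsum_le_tsum fun x => ENNReal.tsum_le_tsum fun k => ENNReal.tsum_le_tsum (h x k)

variable (P)

/-- Mean absolute difference of two classifiers when both observations are drawn independently. -/
noncomputable def gap (f₁ f₂ : X → Fin K → X → ℝ) : ℝ≥0∞ :=
  eexp P.rho fun x => eexp P.lag fun k => eexp P.rho fun x' => ENNReal.ofReal |f₁ x k x' - f₂ x k x'|

/-- The difference of the squared losses of two classifiers at one data point. -/
def lossDiff (f₁ f₂ : X → Fin K → X → ℝ) (t : X × Fin K × X × Bool) : ℝ :=
  (f₁ t.1 t.2.1 t.2.2.1 - if t.2.2.2 then 1 else 0) ^ 2 -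
    (f₂ t.1 t.2.1 t.2.2.1 - if t.2.2.2 then 1 else 0) ^ 2

variable {P}

/-- Multiplied by the mass of both labels at `(x, k, x')`, the weight `1 - p` becomes the mass of
the negative example. Negatives make up half of `D_cont`, which halves the constants `23 / 22` and
`23 / 44`. -/
theorem eexp_exp_lossDiff_le {f f₀ : X → Fin K → X → ℝ}
    (hf : ∀ x k x', 0 ≤ f x k x' ∧ f x k x' ≤ 1)
    (hf₀ : ∀ x k x', P.InSupport x k x' → f₀ x k x' = P.bayes x k x') {e : ℝ} (he0 : 0 ≤ e)
    (he1 : e ≤ 1 / 2) :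
    eexp P.cont (fun t => ENNReal.ofReal (Real.exp (lossDiff f₀ f t))) +
      ENNReal.ofReal (23 / 44 * e) * P.gap f f₀ ≤ 1 + ENNReal.ofReal (23 / 88 * e ^ 2) := by
  have h := eexp_cont_le (P := P)
    (F := fun t => ENNReal.ofReal (Real.exp (lossDiff f₀ f t)) +
      if t.2.2.2 then 0 else
        ENNReal.ofReal (23 / 22 * e) * ENNReal.ofReal |f t.1 t.2.1 t.2.2.1 - f₀ t.1 t.2.1 t.2.2.1|)
    (F' := fun t => 1 + if t.2.2.2 then 0 else ENNReal.ofReal (23 / 44 * e ^ 2)) ?_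
  · rw [eexp_add, eexp_add, eexp_const, P.eexp_cont (fun t => if t.2.2.2 then _ else _),
      P.eexp_cont (fun t => if t.2.2.2 then (0 : ℝ≥0∞) else ENNReal.ofReal (23 / 44 * e ^ 2))] at h
    simp only [if_true, Bool.false_eq_true, if_false, eexp_const, mul_zero, zero_add,
      eexp_const_mul] at h
    have h2 : (2⁻¹ : ℝ≥0∞) = ENNReal.ofReal (1 / 2) := by
      rw [one_div, ENNReal.ofReal_inv_of_pos two_pos]
      simp
    rw [h2, ← mul_assoc, ← ENNReal.ofReal_mul (by norm_num), ← ENNReal.ofReal_mul (by norm_num)] at h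
    convert h using 2
    · rw [gap]
      ring_nf
    · ring_nf
  · intro x k x'
    set c₁ := P.cont (x, k, x', true) with hc₁
    set c₀ := P.cont (x, k, x', false) with hc₀
    have hc₁t : c₁ ≠ ⊤ := P.cont.apply_ne_top _
    have hc₀t : c₀ ≠ ⊤ := P.cont.apply_ne_top _
    simp only [if_true, Bool.false_eq_true, if_false, add_zero, lossDiff]
    by_cases hs : P.InSupport x k x'
    · set p := f₀ x k x' with hp
      have hpb : p = c₁.toReal / (c₁.toReal + c₀.toReal) := hf₀ x k x' hs
      have hpos : 0 < c₁.toReal + c₀.toReal := by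
        obtain ⟨z, hz⟩ := hs
        have hz' := ENNReal.toReal_pos ((PMF.mem_support_iff _ _).1 hz) (PMF.apply_ne_top _ _)
        cases z
        · exact add_pos_of_nonneg_of_pos ENNReal.toReal_nonneg hz'
        · exact add_pos_of_pos_of_nonneg hz' ENNReal.toReal_nonneg
      have hp0 : 0 ≤ p := by rw [hpb]; positivity
      have hp1 : p ≤ 1 := by
        rw [hpb, div_le_one hpos]
        exact le_add_of_nonneg_right ENNReal.toReal_nonneg
      have e₁ : c₁.toReal = (c₁.toReal + c₀.toReal) * p := by
        rw [hpb, mul_div_cancel₀ _ hpos.ne']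
      have e₀ : c₀.toReal = (c₁.toReal + c₀.toReal) * (1 - p) := by linarith
      have key := mul_le_mul_of_nonneg_left
        (exp_excess_loss_le hp0 hp1 (hf x k x').1 (hf x k x').2 he1) hpos.le
      have hreal : c₁.toReal * Real.exp ((p - 1) ^ 2 - (f x k x' - 1) ^ 2) +
          c₀.toReal * (Real.exp ((p - 0) ^ 2 - (f x k x' - 0) ^ 2) +
            23 / 22 * e * |f x k x' - p|) ≤
          c₁.toReal * 1 + c₀.toReal * (1 + 23 / 44 * e ^ 2) := by
        rw [show (p - 1) ^ 2 - (f x k x' - 1) ^ 2 = (1 - p) ^ 2 - (1 - f x k x') ^ 2 by ring,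
          show (p - 0) ^ 2 - (f x k x' - 0) ^ 2 = p ^ 2 - (f x k x') ^ 2 by ring]
        calc _ = (c₁.toReal + c₀.toReal) * ((1 - p) * Real.exp (p ^ 2 - (f x k x') ^ 2) +
              p * Real.exp ((1 - p) ^ 2 - (1 - f x k x') ^ 2) +
              (1 - p) * (23 / 22 * e * |f x k x' - p|)) := by
              linear_combination (Real.exp ((1 - p) ^ 2 - (1 - f x k x') ^ 2)) * e₁ +
                (Real.exp (p ^ 2 - (f x k x') ^ 2) + 23 / 22 * e * |f x k x' - p|) * e₀
          _ ≤ _ := key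
          _ = _ := by linear_combination (-(23 / 44) * e ^ 2) * e₀
      have := ENNReal.ofReal_le_ofReal hreal
      rw [ENNReal.ofReal_add (by positivity) (by positivity),
        ENNReal.ofReal_add (by positivity) (by positivity),
        ENNReal.ofReal_mul ENNReal.toReal_nonneg, ENNReal.ofReal_mul ENNReal.toReal_nonneg,
        ENNReal.ofReal_mul ENNReal.toReal_nonneg, ENNReal.ofReal_mul ENNReal.toReal_nonneg,
        ENNReal.ofReal_add (by positivity) (by positivity),
        ENNReal.ofReal_add (by positivity) (by positivity), ENNReal.ofReal_one,
        ENNReal.ofReal_toReal hc₁t, ENNReal.ofReal_toReal hc₀t,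
        ENNReal.ofReal_mul (by positivity)] at this
      exact this
    · have h1 : c₁ = 0 := by
        by_contra h0
        exact hs ⟨true, (PMF.mem_support_iff _ _).2 h0⟩
      have h0 : c₀ = 0 := by
        by_contra h0
        exact hs ⟨false, (PMF.mem_support_iff _ _).2 h0⟩
      simp [h1, h0]

/-- The classifier given by a regression function and a decoder. -/
def classifier (g : Fin N → Fin K → X → Set.Icc (0 : ℝ) 1) (φ : X → Fin N) :
    X → Fin K → X → ℝ :=
  fun x k x' => g (φ x) k x'

/-- Tail bound for the gap of an empirical risk minimizer. -/
theorem eexp_gap_erm_le {G : Finset (Fin N → Fin K → X → Set.Icc (0 : ℝ) 1)}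
    {Φ : Finset (X → Fin N)} {g₀ : Fin N → Fin K → X → Set.Icc (0 : ℝ) 1} (hg₀ : g₀ ∈ G)
    {φ₀ : X → Fin N} (hφ₀ : φ₀ ∈ Φ)
    (hreal : ∀ x k x', P.InSupport x k x' → (g₀ (φ₀ x) k x' : ℝ) = P.bayes x k x')
    {m : ℕ} (hm : 0 < m)
    {erm : (Fin m → X × Fin K × X × Bool) → (Fin N → Fin K → X → Set.Icc (0 : ℝ) 1) × (X → Fin N)}
    (herm : IsERM G Φ erm) {e : ℝ} (he0 : 0 ≤ e) (he1 : e ≤ 1 / 2) :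
    eexp (iid P.cont m) ({data | ENNReal.ofReal e ≤
        P.gap (classifier (erm data).1 (erm data).2) (classifier g₀ φ₀)}.indicator 1) ≤
      ENNReal.ofReal ((G.card : ℝ) * Φ.card * Real.exp (-(23 / 88 * e ^ 2 * m))) := by
  classical
  set f₀ := classifier g₀ φ₀ with hf₀
  set B := (G ×ˢ Φ).filter fun f => ENNReal.ofReal e ≤ P.gap (classifier f.1 f.2) f₀ with hB
  have hone : ∀ f ∈ B, eexp P.cont (fun t => ENNReal.ofReal
      (Real.exp (lossDiff f₀ (classifier f.1 f.2) t))) ≤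
        ENNReal.ofReal (Real.exp (-(23 / 88 * e ^ 2))) := by
    intro f hf
    have hgap := (Finset.mem_filter.1 hf).2
    have h := eexp_exp_lossDiff_le (P := P) (f := classifier f.1 f.2) (f₀ := f₀)
      (fun x k x' => ⟨(f.1 (f.2 x) k x').2.1, (f.1 (f.2 x) k x').2.2⟩) hreal he0 he1
    have h1 : ENNReal.ofReal (23 / 44 * e) * ENNReal.ofReal e ≤
        ENNReal.ofReal (23 / 44 * e) * P.gap (classifier f.1 f.2) f₀ := by gcongr
    rw [← ENNReal.ofReal_mul (by positivity)] at h1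
    have h2 := (add_le_add_right h1 _).trans h
    -- At gap `e` the linear gain `23 / 44 * e * e` is twice the offset `23 / 88 * e ^ 2`. The
    -- identity is written additively to avoid truncated subtraction.
    have h3 : (1 : ℝ≥0∞) + ENNReal.ofReal (23 / 88 * e ^ 2) =
        ENNReal.ofReal (1 - 23 / 88 * e ^ 2) + ENNReal.ofReal (23 / 44 * e * e) := by
      rw [← ENNReal.ofReal_one, ← ENNReal.ofReal_add (by norm_num) (by positivity),
        ← ENNReal.ofReal_add (by nlinarith) (by positivity)]
      congr 1
      ring
    rw [h3] at h2
    refine (ENNReal.le_of_add_le_add_right ENNReal.ofReal_ne_top h2).trans ?_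
    refine ENNReal.ofReal_le_ofReal ?_
    have := Real.add_one_le_exp (-(23 / 88 * e ^ 2))
    linarith
  -- If the minimizer is bad, its empirical loss is still at most that of `f₀`, so its product of
  -- exponentials is at least 1. Markov's inequality and the union bound are combined here.
  have hbound : ∀ data, ({data | ENNReal.ofReal e ≤
        P.gap (classifier (erm data).1 (erm data).2) f₀}.indicator 1 data : ℝ≥0∞) ≤
      ∑ f ∈ B, ∏ i, ENNReal.ofReal (Real.exp (lossDiff f₀ (classifier f.1 f.2) (data i))) := by
    intro data
    by_cases hd : ENNReal.ofReal e ≤ P.gap (classifier (erm data).1 (erm data).2) f₀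
    · obtain ⟨hG, hΦ, hmin⟩ := herm data
      have hmem : erm data ∈ B := Finset.mem_filter.2 ⟨Finset.mem_product.2 ⟨hG, hΦ⟩, hd⟩
      refine le_trans ?_ (Finset.single_le_sum (fun _ _ => zero_le) hmem)
      rw [← ENNReal.ofReal_prod_of_nonneg fun _ _ => (Real.exp_pos _).le, ← Real.exp_sum]
      have hl := hmin g₀ hg₀ φ₀ hφ₀
      simp only [contLoss] at hl
      have hm' : (0 : ℝ) < 1 / m := by positivity
      have hl' := le_of_mul_le_mul_left hl hm'
      have hsum : 0 ≤ ∑ i, lossDiff f₀ (classifier (erm data).1 (erm data).2) (data i) := by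
        simp only [lossDiff, Finset.sum_sub_distrib]
        exact sub_nonneg.2 hl'
      rw [Set.indicator_of_mem (by exact hd), Pi.one_apply, ← ENNReal.ofReal_one]
      exact ENNReal.ofReal_le_ofReal (Real.one_le_exp hsum)
    · rw [Set.indicator_of_notMem (by exact hd)]
      exact zero_le
  refine (eexp_mono _ hbound).trans ?_
  rw [eexp_sum]
  have hterm : ∀ f ∈ B, eexp (iid P.cont m) (fun data => ∏ i, ENNReal.ofReal
      (Real.exp (lossDiff f₀ (classifier f.1 f.2) (data i)))) ≤
        ENNReal.ofReal (Real.exp (-(23 / 88 * e ^ 2 * m))) := by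
    intro f hf
    rw [eexp_iid_prod P.cont (fun t => ENNReal.ofReal
      (Real.exp (lossDiff f₀ (classifier f.1 f.2) t)))]
    refine (pow_le_pow_left₀ zero_le (hone f hf) m).trans (le_of_eq ?_)
    rw [← ENNReal.ofReal_pow (Real.exp_pos _).le, ← Real.exp_nat_mul]
    ring_nf
  refine (Finset.sum_le_card_nsmul _ _ _ hterm).trans ?_
  have hcard : B.card ≤ G.card * Φ.card :=
    (Finset.card_filter_le _ _).trans (Finset.card_product _ _).le
  rw [ENNReal.ofReal_mul (by positivity), nsmul_eq_mul]
  gcongr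
  rw [← Nat.cast_mul, ENNReal.ofReal_natCast]
  exact_mod_cast hcard

variable (P) in
/-- Mean difference of the Bayes classifier over pairs of observations merged by a decoder. -/
noncomputable def mergeGap (f₀ : X → Fin K → X → ℝ) (φ : X → Fin N) : ℝ :=
  expect P.coup fun t => if φ t.1 = φ t.2.1 then
    |f₀ t.1 t.2.2.1 t.2.2.2 - f₀ t.2.1 t.2.2.1 t.2.2.2| else 0

theorem mergeGap_eq (f₀ : X → Fin K → X → ℝ) (φ : X → Fin N) :
    P.mergeGap f₀ φ = (eexp P.coup fun t => if φ t.1 = φ t.2.1 then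
      ENNReal.ofReal |f₀ t.1 t.2.2.1 t.2.2.2 - f₀ t.2.1 t.2.2.1 t.2.2.2| else 0).toReal := by
  rw [mergeGap, expect_eq_eexp]
  · congr 2
    funext t
    split_ifs <;> simp
  · intro t _
    split_ifs <;> simp

theorem mergeGap_nonneg (f₀ : X → Fin K → X → ℝ) (φ : X → Fin N) : 0 ≤ P.mergeGap f₀ φ := by
  rw [mergeGap_eq]
  exact ENNReal.toReal_nonneg

theorem eexp_coup_le_one {f₀ : X → Fin K → X → ℝ} (hf₀ : ∀ x k x', 0 ≤ f₀ x k x' ∧ f₀ x k x' ≤ 1)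
    (φ : X → Fin N) :
    (eexp P.coup fun t => if φ t.1 = φ t.2.1 then
      ENNReal.ofReal |f₀ t.1 t.2.2.1 t.2.2.2 - f₀ t.2.1 t.2.2.1 t.2.2.2| else 0) ≤ 1 := by
  refine (eexp_mono _ fun t => ?_).trans (eexp_const P.coup 1).le
  split_ifs
  · rw [← ENNReal.ofReal_one]
    refine ENNReal.ofReal_le_ofReal (abs_le.2 ⟨?_, ?_⟩)
    · linarith [(hf₀ t.1 t.2.2.1 t.2.2.2).1, (hf₀ t.2.1 t.2.2.1 t.2.2.2).2]
    · linarith [(hf₀ t.1 t.2.2.1 t.2.2.2).2, (hf₀ t.2.1 t.2.2.1 t.2.2.2).1]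
  · exact zero_le

theorem mergeGap_le_one {f₀ : X → Fin K → X → ℝ} (hf₀ : ∀ x k x', 0 ≤ f₀ x k x' ∧ f₀ x k x' ≤ 1)
    (φ : X → Fin N) : P.mergeGap f₀ φ ≤ 1 := by
  rw [mergeGap_eq]
  exact ENNReal.toReal_le_of_le_ofReal zero_le_one (by simpa using eexp_coup_le_one hf₀ φ)

theorem ofReal_mergeGap_le (g : Fin N → Fin K → X → Set.Icc (0 : ℝ) 1) (φ : X → Fin N)
    {f₀ : X → Fin K → X → ℝ} (hf₀ : ∀ x k x', 0 ≤ f₀ x k x' ∧ f₀ x k x' ≤ 1) :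
    ENNReal.ofReal (P.mergeGap f₀ φ) ≤ 2 * P.gap (classifier g φ) f₀ := by
  rw [mergeGap_eq, ENNReal.ofReal_toReal (ne_top_of_le_ne_top ENNReal.one_ne_top
    (eexp_coup_le_one hf₀ φ))]
  have h : ∀ t : X × X × Fin K × X, (if φ t.1 = φ t.2.1 then
      ENNReal.ofReal |f₀ t.1 t.2.2.1 t.2.2.2 - f₀ t.2.1 t.2.2.1 t.2.2.2| else 0) ≤
      ENNReal.ofReal |classifier g φ t.1 t.2.2.1 t.2.2.2 - f₀ t.1 t.2.2.1 t.2.2.2| +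
      ENNReal.ofReal |classifier g φ t.2.1 t.2.2.1 t.2.2.2 - f₀ t.2.1 t.2.2.1 t.2.2.2| := by
    intro t
    split_ifs with ht
    · rw [← ENNReal.ofReal_add (abs_nonneg _) (abs_nonneg _)]
      refine ENNReal.ofReal_le_ofReal ?_
      simp only [classifier, ht]
      exact (abs_sub_le _ (g (φ t.2.1) t.2.2.1 t.2.2.2 : ℝ) _).trans_eq (by rw [abs_sub_comm])
    · exact zero_le
  refine (eexp_mono _ h).trans (le_of_eq ?_)
  rw [eexp_add, eexp_coup, eexp_coup, two_mul]
  simp only [eexp_const]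
  rfl

/-- The tail bound is used at `e = 2 * Δ`. With `1 / 2` in place of `23 / 44` it would need `n / 2`
data points without rounding; the excess of `23 / 44` pays for the video lost when `n` is odd. If `4
* Δ > 1` there is nothing to prove. -/
theorem mergeGap_erm_lt {G : Finset (Fin N → Fin K → X → Set.Icc (0 : ℝ) 1)}
    {Φ : Finset (X → Fin N)} {g₀ : Fin N → Fin K → X → Set.Icc (0 : ℝ) 1} (hg₀ : g₀ ∈ G)
    {φ₀ : X → Fin N} (hφ₀ : φ₀ ∈ Φ)
    (hreal : ∀ x k x', P.InSupport x k x' → (g₀ (φ₀ x) k x' : ℝ) = P.bayes x k x')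
    {n : ℕ} (hn : 2 ≤ n)
    {erm : (Fin (n / 2) → X × Fin K × X × Bool) →
      (Fin N → Fin K → X → Set.Icc (0 : ℝ) 1) × (X → Fin N)}
    (herm : IsERM G Φ erm) (hcard : 2 ≤ (G.card : ℝ) * Φ.card) {δ : ℝ} (hδ0 : 0 < δ) (hδ1 : δ < 1) :
    1 - δ ≤ prob (iid P.cont (n / 2)) {data | P.mergeGap (classifier g₀ φ₀) (erm data).2 <
      4 * √(2 / (n : ℝ) * Real.log ((G.card : ℝ) * Φ.card / δ))} := by
  set L := Real.log ((G.card : ℝ) * Φ.card / δ) with hL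
  set Δ := √(2 / (n : ℝ) * L) with hΔ
  have hF : 2 ≤ (G.card : ℝ) * Φ.card / δ := by
    rw [le_div_iff₀ hδ0]
    nlinarith
  have hL2 : Real.log 2 ≤ L := Real.log_le_log two_pos hF
  have hlog := Real.log_two_gt_d9
  have hn0 : (0 : ℝ) < n := by positivity
  have hf₀ : ∀ x k x', 0 ≤ classifier g₀ φ₀ x k x' ∧ classifier g₀ φ₀ x k x' ≤ 1 :=
    fun x k x' => (g₀ (φ₀ x) k x').2
  have hΔ0 : 0 ≤ Δ := Real.sqrt_nonneg _
  have hΔ2 : Δ ^ 2 = 2 / n * L := Real.sq_sqrt (mul_nonneg (by positivity) (by linarith))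
  rcases lt_or_ge 1 (4 * Δ) with h4 | h4
  · refine le_trans (by linarith) (one_le_prob_of_forall_support _ fun data _ => ?_)
    exact (mergeGap_le_one hf₀ _).trans_lt h4
  · generalize hm : n / 2 = m at *
    -- `4 * Δ ≤ 1` means `32 * L ≤ n`, and `L ≥ log 2`.
    have hn22 : 22 ≤ n := by
      have h16 : 16 * (2 / n * L) ≤ 1 := by
        rw [← hΔ2]
        nlinarith
      have : 32 * L ≤ n := by
        have : 16 * (2 / n * L) = 32 * L / n := by ring
        rwa [this, div_le_one hn0] at h16
      have : (22 : ℝ) ≤ n := by linarith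
      exact_mod_cast this
    -- Equality holds at `n = 23`, `m = 11`; the factor matches `23 / 88 * 2 ^ 2 * 2 = 23 / 11` in
    -- the exponent.
    have hnm : (n : ℝ) ≤ 23 / 11 * m := by
      have : 11 * n ≤ 23 * m := by omega
      have : (11 : ℝ) * n ≤ 23 * m := by exact_mod_cast this
      linarith
    have htail := eexp_gap_erm_le hg₀ hφ₀ hreal (m := m) (by omega) herm (e := 2 * Δ)
      (by linarith) (by linarith)
    have hexp : (G.card : ℝ) * Φ.card * Real.exp (-(23 / 88 * (2 * Δ) ^ 2 * m)) ≤ δ := by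
      have hle : L ≤ 23 / 88 * (2 * Δ) ^ 2 * m := by
        rw [mul_pow, hΔ2]
        have : 23 / 88 * (2 ^ 2 * (2 / n * L)) * m = (23 / 11 * m) / n * L := by ring
        rw [this]
        exact le_mul_of_one_le_left (by linarith) ((one_le_div hn0).2 hnm)
      have hFpos : 0 < (G.card : ℝ) * Φ.card := by linarith
      calc _ ≤ (G.card : ℝ) * Φ.card * Real.exp (-L) := by gcongr
        _ = δ := by
          rw [Real.exp_neg, hL, Real.exp_log (by positivity), inv_div]
          rw [mul_div_cancel₀ _ hFpos.ne']
    have hadd := prob_add_compl (iid P.cont m) {data | P.mergeGap (classifier g₀ φ₀) (erm data).2 <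
      4 * Δ}
    suffices hbad : prob (iid P.cont m) {data | P.mergeGap (classifier g₀ φ₀) (erm data).2 <
        4 * Δ}ᶜ ≤ δ by linarith
    rw [prob_eq_eexp]
    refine ENNReal.toReal_le_of_le_ofReal hδ0.le ?_
    refine le_trans (eexp_mono _ fun data => ?_) (htail.trans (ENNReal.ofReal_le_ofReal hexp))
    refine Set.indicator_le_indicator_of_subset (fun data hd => ?_) (by simp) data
    replace hd : 4 * Δ ≤ P.mergeGap (classifier g₀ φ₀) (erm data).2 := not_lt.1 hd
    have h1 := (ENNReal.ofReal_le_ofReal hd).trans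
      (ofReal_mergeGap_le (P := P) (erm data).1 (erm data).2 hf₀)
    rw [show 4 * Δ = 2 * (2 * Δ) by ring, ENNReal.ofReal_mul zero_le_two,
      ENNReal.ofReal_ofNat] at h1
    exact (ENNReal.mul_le_mul_iff_right two_ne_zero ENNReal.ofNat_ne_top).1 h1

/-- With a single hypothesis, nothing is merged that the Bayes classifier separates. -/
theorem mergeGap_eq_zero {g₀ : Fin N → Fin K → X → Set.Icc (0 : ℝ) 1} {φ₀ : X → Fin N} :
    P.mergeGap (classifier g₀ φ₀) φ₀ = 0 := by
  refine le_antisymm ?_ (mergeGap_nonneg _ _)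
  have := ofReal_mergeGap_le (P := P) g₀ φ₀ (f₀ := classifier g₀ φ₀)
    (fun x k x' => (g₀ (φ₀ x) k x').2)
  simpa [gap, eexp_const] using this

/-- Covers the case excluded from `mergeGap_erm_lt`, where the logarithm may be close to 0. -/
theorem erm_eq_of_card_lt_two {G : Finset (Fin N → Fin K → X → Set.Icc (0 : ℝ) 1)}
    {Φ : Finset (X → Fin N)} {g₀ : Fin N → Fin K → X → Set.Icc (0 : ℝ) 1} (hg₀ : g₀ ∈ G)
    {φ₀ : X → Fin N} (hφ₀ : φ₀ ∈ Φ) {m : ℕ}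
    {erm : (Fin m → X × Fin K × X × Bool) → (Fin N → Fin K → X → Set.Icc (0 : ℝ) 1) × (X → Fin N)}
    (herm : IsERM G Φ erm) (hcard : (G.card : ℝ) * Φ.card < 2) (data) : (erm data).2 = φ₀ := by
  have h1 : G.card * Φ.card < 2 := by exact_mod_cast hcard
  have hG : 0 < G.card := Finset.card_pos.2 ⟨_, hg₀⟩
  have hΦ : Φ.card ≤ 1 := by nlinarith
  exact Finset.card_le_one.1 hΦ _ (herm data).2.1 _ hφ₀

/-! ### From the merging gap to the merging probability. -/

variable [Fintype S]

theorem eexp_rho_decode (f : S → ℝ≥0∞) :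
    eexp P.rho (fun x => f (P.env.decode x)) = ∑ s, ENNReal.ofReal (P.rhoState s) * f s := by
  classical
  simp only [rhoState, ofReal_prob, ← eexp_mul_const]
  rw [← eexp_sum]
  refine eexp_congr_support _ fun x _ => ?_
  rw [Finset.sum_eq_single (P.env.decode x)]
  · simp
  · intro s _ hs
    simp [hs.symm]
  · simp

/-- The margin condition turns a bound on `mergeGap` into one for the merging probability. -/
theorem prob_merge_le (hP : P.NoiseFree) {β : ℝ} (hβ : P.Margin β)
    {g₀ : Fin N → Fin K → X → Set.Icc (0 : ℝ) 1} {φ₀ : X → Fin N}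
    (hreal : ∀ x k x', P.InSupport x k x' → (g₀ (φ₀ x) k x' : ℝ) = P.bayes x k x')
    (φ : X → Fin N) :
    2 * β * prob P.twoRho {p | φ p.1 = φ p.2 ∧ P.env.decode p.1 ≠ P.env.decode p.2} ≤
      P.mergeGap (classifier g₀ φ₀) φ := by
  classical
  have hf₀ : ∀ x k x', 0 ≤ classifier g₀ φ₀ x k x' ∧ classifier g₀ φ₀ x k x' ≤ 1 :=
    fun x k x' => (g₀ (φ₀ x) k x').2
  rw [mergeGap_eq, ← ENNReal.ofReal_le_iff_le_toReal (ne_top_of_le_ne_top ENNReal.one_ne_top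
    (eexp_coup_le_one hf₀ φ)), ENNReal.ofReal_mul (by linarith [hβ.1]), ofReal_prob,
    ← eexp_const_mul, eexp_twoRho, eexp_coup]
  refine eexp_mono_support _ fun x₁ hx₁ => eexp_mono_support _ fun x₂ hx₂ => ?_
  by_cases h : φ x₁ = φ x₂ ∧ P.env.decode x₁ ≠ P.env.decode x₂
  -- Both triples occur as negative examples, so the classifier there is the Bayes classifier of the
  -- latent states.
  · have hin : ∀ k ∈ P.lag.support, ∀ x' ∈ P.rho.support,
        ENNReal.ofReal |classifier g₀ φ₀ x₁ k x' - classifier g₀ φ₀ x₂ k x'| =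
        (fun s' => ENNReal.ofReal |P.bayesState (P.env.decode x₁) k s' -
          P.bayesState (P.env.decode x₂) k s'|) (P.env.decode x') := by
      intro k hk x' hx'
      have i1 := inSupport_of_rho hx₁ hk hx'
      have i2 := inSupport_of_rho hx₂ hk hx'
      simp only [classifier]
      rw [hreal _ _ _ i1, hreal _ _ _ i2, (bayes_eq hP i1).2.2, (bayes_eq hP i2).2.2]
    simp only [h.1, if_true]
    rw [eexp_congr_support P.lag fun k hk =>
      (eexp_congr_support P.rho (hin k hk)).trans (eexp_rho_decode fun s' => ENNReal.ofReal
        |P.bayesState (P.env.decode x₁) k s' - P.bayesState (P.env.decode x₂) k s'|)]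
    rw [Set.indicator_of_mem (by exact h), Pi.one_apply, mul_one, eexp_fintype]
    have hm := hβ.2 _ _ h.2
    refine (ENNReal.ofReal_le_ofReal (show 2 * β ≤ _ by linarith)).trans ?_
    rw [ENNReal.ofReal_sum_of_nonneg]
    · refine Finset.sum_le_sum fun k _ => ?_
      rw [ENNReal.ofReal_sum_of_nonneg, Finset.mul_sum]
      · refine Finset.sum_le_sum fun s' _ => ?_
        rw [ENNReal.ofReal_mul (mul_nonneg ENNReal.toReal_nonneg (P.rhoState_nonneg _)),
          ENNReal.ofReal_mul ENNReal.toReal_nonneg, ENNReal.ofReal_toReal (P.lag.apply_ne_top k),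
          mul_assoc]
      · intro s' _
        have := P.rhoState_nonneg s'
        positivity
    · intro k _
      refine Finset.sum_nonneg fun s' _ => ?_
      have := P.rhoState_nonneg s'
      positivity
  · rw [Set.indicator_of_notMem (by exact h), mul_zero]
    exact zero_le

end VideoProcess

end VideoRL

/-! ### Recovery of the latent states up to relabeling. -/

namespace VideoRL

open scoped ENNReal

/-- Distributions over as many labels as there are states which pairwise hardly overlap are almost
concentrated, on a different label for each state. -/
theorem exists_equiv_of_mul_le {S : Type*} [Fintype S] {q : S → Fin (Fintype.card S) → ℝ}
    (hq0 : ∀ s i, 0 ≤ q s i) (hq1 : ∀ s, ∑ i, q s i = 1) {κ : ℝ} (hκ0 : 0 ≤ κ)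
    (hκ : ∀ s s', s ≠ s' → ∀ i, q s i * q s' i ≤ κ)
    (hκ1 : (Fintype.card S : ℝ) ^ 2 * κ < 1) :
    ∃ α : S ≃ Fin (Fintype.card S), ∀ s, 1 - (Fintype.card S : ℝ) ^ 2 * κ ≤ q s (α s) := by
  classical
  -- Some label has at least average mass. Two states sharing such a label would overlap by at least
  -- the inverse square of the number of states, more than `κ`.
  have hmax : ∀ s : S, ∃ i, 1 ≤ (Fintype.card S : ℝ) * q s i := by
    intro s
    by_contra! h
    have hne : (Finset.univ : Finset (Fin (Fintype.card S))).Nonempty :=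
      ⟨Fintype.equivFin S s, Finset.mem_univ _⟩
    have hlt := Finset.sum_lt_sum_of_nonempty hne fun i _ => h i
    rw [← Finset.mul_sum, hq1] at hlt
    simp at hlt
  choose a ha using hmax
  have hinj : Function.Injective a := by
    intro s s' he
    by_contra hne
    have h1 := hκ s s' hne (a s)
    have h2 := ha s'
    rw [← he] at h2
    have h3 := mul_le_mul (ha s) h2 zero_le_one (by linarith [ha s])
    nlinarith [sq_nonneg (Fintype.card S : ℝ)]
  refine ⟨Equiv.ofBijective a ((Fintype.bijective_iff_injective_and_card a).2 ⟨hinj, by simp⟩),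
    fun s => ?_⟩
  set α := Equiv.ofBijective a ((Fintype.bijective_iff_injective_and_card a).2 ⟨hinj, by simp⟩)
    with hα
  have hsum := hq1 s
  rw [← Equiv.sum_comp α, ← Finset.add_sum_erase _ _ (Finset.mem_univ s)] at hsum
  -- As `α` is onto, every wrong label is the heavy label of another state, so the small overlap
  -- bounds its mass under `s`.
  have hterm : ∀ s' ∈ Finset.univ.erase s, q s (α s') ≤ (Fintype.card S : ℝ) * κ := by
    intro s' hs'
    have h1 := hκ s s' (Finset.ne_of_mem_erase hs').symm (α s')
    have h2 : 1 ≤ (Fintype.card S : ℝ) * q s' (α s') := ha s'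
    calc q s (α s') ≤ q s (α s') * ((Fintype.card S : ℝ) * q s' (α s')) :=
          le_mul_of_one_le_right (hq0 _ _) h2
      _ = (Fintype.card S : ℝ) * (q s (α s') * q s' (α s')) := by ring
      _ ≤ _ := by gcongr
  have h := Finset.sum_le_card_nsmul _ _ _ hterm
  rw [nsmul_eq_mul] at h
  have hc : ((Finset.univ.erase s).card : ℝ) ≤ Fintype.card S := by
    exact_mod_cast Finset.card_le_univ _
  have h2 : ((Finset.univ.erase s).card : ℝ) * ((Fintype.card S : ℝ) * κ) ≤
      (Fintype.card S : ℝ) * ((Fintype.card S : ℝ) * κ) := by gcongr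
  rw [sq, mul_assoc]
  linarith

namespace VideoProcess

variable {X S A : Type*} {H K N : ℕ} [NeZero H] {P : VideoProcess X S A H K}

theorem eexp_rho_restrict (hP : P.NoiseFree) (s : S) (F : X → ℝ≥0∞) :
    eexp P.rho ({x | P.env.decode x = s}.indicator F) =
      ENNReal.ofReal (P.rhoState s) * eexp (P.env.emit s) F := by
  rw [← eexp_const_mul]
  refine tsum_congr fun x => ?_
  by_cases hx : P.env.decode x = s
  · have h := rho_apply hP x
    rw [Set.indicator_of_mem (by exact hx), ← ENNReal.ofReal_toReal (P.rho.apply_ne_top x), h,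
      ENNReal.ofReal_mul ENNReal.toReal_nonneg, ENNReal.ofReal_toReal (PMF.apply_ne_top _ _), hx]
    ring
  · rw [Set.indicator_of_notMem (by exact hx), (PMF.apply_eq_zero_iff _ _).2 fun h =>
      hx (P.env.decode_emit s x h)]
    simp

/-- `ρ(s)` is an average over `H` steps, and coverage provides one step with probability at least
`η`. -/
theorem rhoState_ge {Pol : Set (ℕ → X → A)} {η : ℝ} (hcov : P.Coverage Pol η) (s : S) :
    η / H ≤ P.rhoState s := by
  obtain ⟨h, hs⟩ := hcov.1 s
  have hη := hcov.2 s h hs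
  have hH : (0 : ℝ) < H := by exact_mod_cast NeZero.pos H
  have e : ENNReal.ofReal (P.rhoState s) = (H : ℝ≥0∞)⁻¹ * ∑ h' : Fin H,
      ENNReal.ofReal (prob P.video {v | P.env.decode (v (Fin.castAdd K h')) = s}) := by
    rw [rhoState, ofReal_prob, eexp_rho, eexp_comm, eexp_uniform, Fintype.card_fin]
    simp only [ofReal_prob]
    rfl
  have h1 : ENNReal.ofReal (η / H) ≤ ENNReal.ofReal (P.rhoState s) := by
    rw [e, div_eq_inv_mul, ENNReal.ofReal_mul (by positivity), ENNReal.ofReal_inv_of_pos hH,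
      ENNReal.ofReal_natCast]
    gcongr
    exact (ENNReal.ofReal_le_ofReal hη).trans
      (Finset.single_le_sum (f := fun h' : Fin H => ENNReal.ofReal
        (prob P.video {v | P.env.decode (v (Fin.castAdd K h')) = s}))
        (fun _ _ => zero_le) (Finset.mem_univ h))
  exact (ENNReal.ofReal_le_ofReal_iff (P.rhoState_nonneg s)).1 h1

/-- One way of merging is that `x₁` comes from `s`, `x₂` from `s'`, and both get label `i`;
independence gives the product. -/
theorem prob_emit_mul_le (hP : P.NoiseFree) (φ : X → Fin N) {s s' : S} (hs : s ≠ s') (i : Fin N) :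
    P.rhoState s * P.rhoState s' *
      (prob (P.env.emit s) {x | φ x = i} * prob (P.env.emit s') {x | φ x = i}) ≤
    prob P.twoRho {p | φ p.1 = φ p.2 ∧ P.env.decode p.1 ≠ P.env.decode p.2} := by
  refine (ENNReal.ofReal_le_ofReal_iff (prob_nonneg _ _)).1 ?_
  have e : ∀ s, ENNReal.ofReal (P.rhoState s) * ENNReal.ofReal (prob (P.env.emit s) {x | φ x = i}) =
      eexp P.rho ({x | P.env.decode x = s}.indicator ({x | φ x = i}.indicator 1)) := by
    intro s
    rw [eexp_rho_restrict hP, ofReal_prob]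
  rw [mul_mul_mul_comm, ENNReal.ofReal_mul (mul_nonneg (P.rhoState_nonneg _) (prob_nonneg _ _)),
    ENNReal.ofReal_mul (P.rhoState_nonneg _), ENNReal.ofReal_mul (P.rhoState_nonneg _), e, e,
    ofReal_prob, eexp_twoRho, ← eexp_mul_const]
  refine eexp_mono _ fun x₁ => ?_
  rw [← eexp_const_mul]
  refine eexp_mono _ fun x₂ => ?_
  by_cases h1 : P.env.decode x₁ = s <;> by_cases h2 : P.env.decode x₂ = s' <;>
    by_cases h3 : φ x₁ = i <;> by_cases h4 : φ x₂ = i <;> simp [h1, h2, h3, h4, hs]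

omit [NeZero H] in
theorem sum_prob_emit (φ : X → Fin N) (s : S) :
    ∑ i, prob (P.env.emit s) {x | φ x = i} = 1 := by
  classical
  simp only [prob_eq_eexp]
  rw [← ENNReal.toReal_sum fun i _ => eexp_indicator_ne_top _ _, ← eexp_sum]
  rw [eexp_congr_support _ (g := fun _ => 1), eexp_const, ENNReal.toReal_one]
  intro x _
  rw [Finset.sum_eq_single (φ x)]
  · simp
  · intro i _ hi
    simp [hi.symm]
  · simp

/-- A small merging probability makes the decoder recover the latent states up to relabeling. -/
theorem exists_equiv_of_prob_merge_le [Fintype S] (hP : P.NoiseFree) {Pol : Set (ℕ → X → A)} {η : ℝ}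
    (hη : 0 < η) (hcov : P.Coverage Pol η) (φ : X → Fin (Fintype.card S)) {b : ℝ}
    (hb : prob P.twoRho {p | φ p.1 = φ p.2 ∧ P.env.decode p.1 ≠ P.env.decode p.2} ≤ b)
    (hb1 : (Fintype.card S : ℝ) ^ 2 * (H ^ 2 / η ^ 2 * b) < 1) :
    ∃ α : S ≃ Fin (Fintype.card S), ∀ s,
      1 - (Fintype.card S : ℝ) ^ 2 * (H ^ 2 / η ^ 2 * b) ≤ prob (P.env.emit s) {x | φ x = α s} := by
  have hb0 : 0 ≤ b := (prob_nonneg _ _).trans hb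
  have hH : (0 : ℝ) < H := by exact_mod_cast NeZero.pos H
  refine exists_equiv_of_mul_le (q := fun s i => prob (P.env.emit s) {x | φ x = i})
    (fun s i => prob_nonneg _ _) (fun s => sum_prob_emit φ s) (by positivity) ?_ hb1
  intro s s' hs i
  have h1 := (prob_emit_mul_le hP φ hs i).trans hb
  set q := prob (P.env.emit s) {x | φ x = i} * prob (P.env.emit s') {x | φ x = i} with hq
  have hq0 : 0 ≤ q := mul_nonneg (prob_nonneg _ _) (prob_nonneg _ _)
  have h2 : η / H * (η / H) ≤ P.rhoState s * P.rhoState s' :=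
    mul_le_mul (rhoState_ge hcov s) (rhoState_ge hcov s') (by positivity) (P.rhoState_nonneg s)
  have h3 : η / H * (η / H) * q ≤ b := (mul_le_mul_of_nonneg_right h2 hq0).trans h1
  calc q = H ^ 2 / η ^ 2 * (η / H * (η / H) * q) := by field_simp
    _ ≤ _ := by gcongr

end VideoProcess

end VideoRL

/-! ### Interaction through a decoder compared with the relabeled latent MDP. -/

namespace VideoRL

open scoped ENNReal

variable {X S A O : Type*}

/-- A tabular MDP with its states renamed. -/
noncomputable def TabularMDP.relabel (M : TabularMDP S A) (α : S ≃ O) : TabularMDP O A where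
  init := M.init.map α
  trans i a := (M.trans (α.symm i) a).map α
  reward i a := M.reward (α.symm i) a
  reward_nonneg _ _ := M.reward_nonneg _ _
  reward_le_one _ _ := M.reward_le_one _ _

section Domination

variable {M : BlockMDP X S A} {α : S ≃ O} {φ : X → O} {c : ℝ≥0∞}

/-- Discard all emissions with a wrong label. On the rest the agent records what it would record in
the relabeled MDP, and each step costs a factor `c`. This one-sided comparison replaces a coupling
of the two runs. -/
theorem eexp_episodeFrom_ge (hc : ∀ s, c ≤ eexp (M.emit s) ({x | φ x = α s}.indicator 1))
    (act : Episode O A → O → PMF A) (L : ℕ) (past : Episode O A) (s : S)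
    (f : Episode O A → ℝ≥0∞) :
    c ^ L * eexp ((M.toTabularMDP.relabel α).toBlock.episodeFrom id act L past (α s)) f ≤
      eexp (M.episodeFrom φ act L past s) f := by
  induction L generalizing past s with
  | zero => simp [BlockMDP.episodeFrom]
  | succ L ih =>
    simp only [BlockMDP.episodeFrom, eexp_bind, TabularMDP.toBlock, TabularMDP.relabel, eexp_pure,
      id, eexp_map, Equiv.symm_apply_apply]
    set V := eexp (act past (α s)) fun a => eexp (M.trans s a) fun s' =>
      eexp (M.episodeFrom φ act L (past ++ [(α s, a, M.reward s a)]) s') f with hV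
    calc _ ≤ c * V := by
          rw [pow_succ', mul_assoc]
          gcongr
          rw [hV, ← eexp_const_mul]
          refine eexp_mono _ fun a => ?_
          rw [← eexp_const_mul]
          exact eexp_mono _ fun s' => ih _ s'
      _ ≤ eexp (M.emit s) ({x | φ x = α s}.indicator 1) * V := by
          gcongr
          exact hc s
      _ ≤ _ := by
          rw [← eexp_mul_const]
          refine eexp_mono _ fun x => ?_
          by_cases hx : φ x = α s <;> simp [hx, hV]

theorem eexp_episode_ge (hc : ∀ s, c ≤ eexp (M.emit s) ({x | φ x = α s}.indicator 1))
    (act : Episode O A → O → PMF A) (H : ℕ) (f : Episode O A → ℝ≥0∞) :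
    c ^ H * eexp ((M.toTabularMDP.relabel α).toBlock.episode H id act) f ≤
      eexp (M.episode H φ act) f := by
  have hinit : (M.toTabularMDP.relabel α).toBlock.init = M.init.map α := rfl
  simp only [BlockMDP.episode, eexp_bind, hinit, eexp_map]
  rw [← eexp_const_mul]
  exact eexp_mono _ fun s => eexp_episodeFrom_ge hc act H [] s f

theorem eexp_interact_ge (hc : ∀ s, c ≤ eexp (M.emit s) ({x | φ x = α s}.indicator 1))
    (alg : EpisodicAlg O A) (H m : ℕ) (f : List (Episode O A) → ℝ≥0∞) :
    c ^ (H * m) * eexp (interact (M.toTabularMDP.relabel α).toBlock H id alg m) f ≤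
      eexp (interact M H φ alg m) f := by
  induction m generalizing f with
  | zero => simp [interact]
  | succ m ih =>
    simp only [interact, eexp_bind, eexp_map]
    rw [Nat.mul_succ, pow_add, mul_assoc, ← eexp_const_mul]
    refine le_trans ?_ (ih _)
    gcongr
    exact eexp_mono _ fun log => eexp_episode_ge hc _ H _

/-- Running an algorithm through a decoder that is right with probability at least `c` dominates,
up to the factor `c ^ (H * m)`, running it in the relabeled latent MDP. -/
theorem eexp_runAlg_ge (hc : ∀ s, c ≤ eexp (M.emit s) ({x | φ x = α s}.indicator 1))
    (alg : EpisodicAlg O A) (H m : ℕ) (f : List (Episode O A) × (ℕ → O → A) → ℝ≥0∞) :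
    c ^ (H * m) * eexp (runAlg (M.toTabularMDP.relabel α).toBlock H id alg m) f ≤
      eexp (runAlg M H φ alg m) f := by
  simp only [runAlg, eexp_bind]
  exact eexp_interact_ge hc alg H m _

theorem length_of_mem_runAlg {H m : ℕ} {alg : EpisodicAlg O A}
    {r : List (Episode O A) × (ℕ → O → A)} (hr : r ∈ (runAlg M H φ alg m).support) :
    r.1.length = m := by
  simp only [runAlg, PMF.mem_support_bind_iff, PMF.mem_support_map_iff] at hr
  obtain ⟨log, hlog, ψ, hψ, rfl⟩ := hr
  change log.length = m
  clear hψ ψ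
  induction m generalizing log with
  | zero => simpa [interact] using hlog
  | succ m ih =>
    simp only [interact, PMF.mem_support_bind_iff, PMF.mem_support_map_iff] at hlog
    obtain ⟨log', hlog', e, _, rfl⟩ := hlog
    simp [ih log' hlog']

end Domination

/-! ### Values of policies and dynamic programming. -/

section Value

/-- Expected total reward over `L` steps from latent state `s` in step `h`. -/
noncomputable def BlockMDP.valueFrom (M : BlockMDP X S A) (π : ℕ → X → A) :
    ℕ → ℕ → S → ℝ≥0∞
  | 0, _, _ => 0
  | L + 1, h, s => eexp (M.emit s) fun x => ENNReal.ofReal (M.reward s (π h x)) +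
      eexp (M.trans s (π h x)) fun s' => M.valueFrom π L (h + 1) s'

theorem BlockMDP.valueFrom_le (M : BlockMDP X S A) (π : ℕ → X → A) (L h : ℕ) (s : S) :
    M.valueFrom π L h s ≤ L := by
  induction L generalizing h s with
  | zero => simp [valueFrom]
  | succ L ih =>
    refine (eexp_mono _ fun x => ?_).trans (eexp_const (M.emit s) _).le
    rw [Nat.cast_succ, add_comm]
    refine add_le_add ?_ ?_
    · exact (eexp_mono _ fun s' => ih _ s').trans (eexp_const _ _).le
    · exact ENNReal.ofReal_le_one.2 (M.reward_le_one _ _)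

theorem eexp_episodeFrom_reward (M : BlockMDP X S A) (π : ℕ → X → A) (L : ℕ)
    (past : Episode X A) (s : S) :
    eexp (M.episodeFrom id (fun past x => PMF.pure (π past.length x)) L past s)
      (fun e => (e.map fun t => ENNReal.ofReal t.2.2).sum) =
    (past.map fun t => ENNReal.ofReal t.2.2).sum + M.valueFrom π L past.length s := by
  induction L generalizing past s with
  | zero => simp [BlockMDP.episodeFrom, BlockMDP.valueFrom, eexp_pure]
  | succ L ih =>
    simp only [BlockMDP.episodeFrom, eexp_bind, eexp_pure, ih, BlockMDP.valueFrom, id,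
      List.map_append, List.sum_append, List.map_cons, List.map_nil, List.sum_cons, List.sum_nil,
      add_zero, List.length_append, List.length_cons, List.length_nil, zero_add, eexp_add,
      eexp_const, add_assoc]

theorem reward_nonneg_of_mem_episodeFrom {M : BlockMDP X S A} {φ : X → O}
    {act : Episode O A → O → PMF A} {L : ℕ} {past : Episode O A} {s : S}
    (hpast : ∀ t ∈ past, 0 ≤ t.2.2) {e : Episode O A}
    (he : e ∈ (M.episodeFrom φ act L past s).support) : ∀ t ∈ e, 0 ≤ t.2.2 := by
  induction L generalizing past s with
  | zero =>
    simp only [BlockMDP.episodeFrom, PMF.support_pure, Set.mem_singleton_iff] at he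
    rwa [he]
  | succ L ih =>
    simp only [BlockMDP.episodeFrom, PMF.mem_support_bind_iff] at he
    obtain ⟨x, _, a, _, s', _, he⟩ := he
    refine ih (fun t ht => ?_) he
    rcases List.mem_append.1 ht with ht | ht
    · exact hpast t ht
    · rw [List.mem_singleton.1 ht]
      exact M.reward_nonneg s a

theorem BlockMDP.value_eq (M : BlockMDP X S A) (H : ℕ) (π : ℕ → X → A) :
    M.value H π = (eexp M.init fun s => M.valueFrom π H 0 s).toReal := by
  have hnn : ∀ e ∈ (M.episode H id fun past x => PMF.pure (π past.length x)).support,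
      ∀ t ∈ e, 0 ≤ t.2.2 := by
    intro e he
    simp only [BlockMDP.episode, PMF.mem_support_bind_iff] at he
    obtain ⟨s, _, he⟩ := he
    exact reward_nonneg_of_mem_episodeFrom (by simp) he
  have hsum : ∀ e : Episode X A, (∀ t ∈ e, 0 ≤ t.2.2) → 0 ≤ (e.map fun t => t.2.2).sum ∧
      ENNReal.ofReal (e.map fun t => t.2.2).sum = (e.map fun t => ENNReal.ofReal t.2.2).sum := by
    intro e he
    induction e with
    | nil => simp
    | cons t e ih =>
      obtain ⟨h1, h2⟩ := ih fun t' ht' => he t' (List.mem_cons_of_mem _ ht')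
      have h3 := he t List.mem_cons_self
      simp only [List.map_cons, List.sum_cons]
      exact ⟨add_nonneg h3 h1, by rw [ENNReal.ofReal_add h3 h1, h2]⟩
  rw [BlockMDP.value, expect_eq_eexp _ fun e he => (hsum e (hnn e he)).1,
    eexp_congr_support _ fun e he => (hsum e (hnn e he)).2, BlockMDP.episode, eexp_bind]
  simp only [eexp_episodeFrom_reward]
  simp

theorem BlockMDP.eexp_valueFrom_le (M : BlockMDP X S A) (H : ℕ) (π : ℕ → X → A) :
    (eexp M.init fun s => M.valueFrom π H 0 s) ≤ H :=
  (eexp_mono _ fun s => M.valueFrom_le π H 0 s).trans (eexp_const _ _).le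

theorem BlockMDP.ofReal_value (M : BlockMDP X S A) (H : ℕ) (π : ℕ → X → A) :
    ENNReal.ofReal (M.value H π) = eexp M.init fun s => M.valueFrom π H 0 s := by
  rw [value_eq, ENNReal.ofReal_toReal]
  exact ne_top_of_le_ne_top (ENNReal.natCast_ne_top H) (M.eexp_valueFrom_le H π)

theorem BlockMDP.value_nonneg (M : BlockMDP X S A) (H : ℕ) (π : ℕ → X → A) : 0 ≤ M.value H π := by
  rw [value_eq]
  exact ENNReal.toReal_nonneg

theorem BlockMDP.value_le (M : BlockMDP X S A) (H : ℕ) (π : ℕ → X → A) : M.value H π ≤ H := by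
  rw [value_eq]
  exact ENNReal.toReal_le_of_le_ofReal (by positivity) (by simpa using M.eexp_valueFrom_le H π)

/-- The same truncation to correctly decoded steps; rewards are nonnegative, so dropping the rest
only lowers the value. `c ≤ 1` allows the immediate reward to be discounted as well. -/
theorem valueFrom_comp_ge {M : BlockMDP X S A} {α : S ≃ O} {φ : X → O} {c : ℝ≥0∞} (hc1 : c ≤ 1)
    (hc : ∀ s, c ≤ eexp (M.emit s) ({x | φ x = α s}.indicator 1)) (ψ : ℕ → O → A) (L h : ℕ) (s : S) :
    c ^ L * (M.toTabularMDP.relabel α).toBlock.valueFrom ψ L h (α s) ≤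
      M.valueFrom (fun h x => ψ h (φ x)) L h s := by
  induction L generalizing h s with
  | zero => simp [BlockMDP.valueFrom]
  | succ L ih =>
    simp only [BlockMDP.valueFrom, TabularMDP.toBlock, TabularMDP.relabel, eexp_pure, eexp_map,
      Equiv.symm_apply_apply]
    set V := ENNReal.ofReal (M.reward s (ψ h (α s))) + eexp (M.trans s (ψ h (α s))) fun s' =>
      M.valueFrom (fun h x => ψ h (φ x)) L (h + 1) s' with hV
    calc _ ≤ c * V := by
          rw [pow_succ', mul_assoc]
          gcongr
          rw [hV, mul_add]
          refine add_le_add (mul_le_of_le_one_left zero_le (pow_le_one₀ zero_le hc1)) ?_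
          rw [← eexp_const_mul]
          exact eexp_mono _ fun s' => ih _ s'
      _ ≤ eexp (M.emit s) ({x | φ x = α s}.indicator 1) * V := by
          gcongr
          exact hc s
      _ ≤ _ := by
          rw [← eexp_mul_const]
          refine eexp_mono _ fun x => ?_
          by_cases hx : φ x = α s <;> simp [hx, hV]

/-- Bernoulli's inequality `(1 - ξ) ^ H ≥ 1 - H * ξ` applied to a value of at most `H`. -/
theorem value_comp_ge {M : BlockMDP X S A} {α : S ≃ O} {φ : X → O} {ξ : ℝ} (hξ0 : 0 ≤ ξ)
    (hξ1 : ξ ≤ 1) (hξ : ∀ s, 1 - ξ ≤ prob (M.emit s) {x | φ x = α s}) (ψ : ℕ → O → A) (H : ℕ) :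
    (M.toTabularMDP.relabel α).toBlock.value H ψ - H ^ 2 * ξ ≤
      M.value H fun h x => ψ h (φ x) := by
  have hc : ∀ s, ENNReal.ofReal (1 - ξ) ≤ eexp (M.emit s) ({x | φ x = α s}.indicator 1) :=
    fun s => by
      rw [← ofReal_prob]
      exact ENNReal.ofReal_le_ofReal (hξ s)
  have h : (1 - ξ) ^ H * (M.toTabularMDP.relabel α).toBlock.value H ψ ≤
      M.value H fun h x => ψ h (φ x) := by
    refine (ENNReal.ofReal_le_ofReal_iff (M.value_nonneg H _)).1 ?_
    rw [ENNReal.ofReal_mul (pow_nonneg (by linarith) _), ENNReal.ofReal_pow (by linarith),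
      BlockMDP.ofReal_value, BlockMDP.ofReal_value]
    have hinit : (M.toTabularMDP.relabel α).toBlock.init = M.init.map α := rfl
    rw [hinit, eexp_map, ← eexp_const_mul]
    exact eexp_mono _ fun s =>
      valueFrom_comp_ge (ENNReal.ofReal_le_one.2 (by linarith)) hc ψ H 0 s
  have hb := one_add_mul_le_pow (show -2 ≤ -ξ by linarith) H
  rw [← sub_eq_add_neg] at hb
  have h0 := (M.toTabularMDP.relabel α).toBlock.value_nonneg H ψ
  have h1 := (M.toTabularMDP.relabel α).toBlock.value_le H ψ
  have h2 := mul_le_mul_of_nonneg_right hb h0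
  have h3 : H * ξ * (M.toTabularMDP.relabel α).toBlock.value H ψ ≤ H * ξ * H := by gcongr
  nlinarith

/-- Optimal value with `L` steps to go. -/
noncomputable def TabularMDP.optValue (M : TabularMDP O A) : ℕ → O → ℝ≥0∞
  | 0, _ => 0
  | L + 1, i => ⨆ a, ENNReal.ofReal (M.reward i a) + eexp (M.trans i a) (M.optValue L)

/-- Some policy of the latent MDP does at least as well as every policy of the Block MDP. -/
theorem exists_policy_value_ge [Finite A] [Nonempty A] (M : BlockMDP X S A) (α : S ≃ O) (H : ℕ) :
    ∃ ψ : ℕ → O → A, ∀ π : ℕ → X → A,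
      M.value H π ≤ (M.toTabularMDP.relabel α).toBlock.value H ψ := by
  set M' := M.toTabularMDP.relabel α with hM'
  have hex : ∀ (L : ℕ) (i : O), ∃ a, ENNReal.ofReal (M'.reward i a) +
      eexp (M'.trans i a) (M'.optValue L) = M'.optValue (L + 1) i :=
    fun L i => exists_eq_ciSup_of_finite
  choose act hact using hex
  -- `act L` is optimal when `L` steps follow the current one; steps count from 0, so `H - h - 1`
  -- follow step `h`.
  refine ⟨fun h i => act (H - h - 1) i, fun π => ?_⟩
  -- Given the latent state, the observation matters only through the action it triggers, and every
  -- action is at most the best one.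
  have hup : ∀ L h s, M.valueFrom π L h s ≤ M'.optValue L (α s) := by
    intro L
    induction L with
    | zero => simp [BlockMDP.valueFrom]
    | succ L ih =>
      intro h s
      refine (eexp_mono _ fun x => ?_).trans (eexp_const (M.emit s) _).le
      refine le_trans ?_ (le_iSup _ (π h x))
      simp only [hM', TabularMDP.relabel, Equiv.symm_apply_apply, eexp_map]
      gcongr
      exact eexp_mono _ fun s' => ih _ s'
  have hdown : ∀ L h i, h + L = H →
      M'.toBlock.valueFrom (fun h i => act (H - h - 1) i) L h i = M'.optValue L i := by
    intro L
    induction L with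
    | zero => simp [BlockMDP.valueFrom, TabularMDP.optValue]
    | succ L ih =>
      intro h i hh
      simp only [BlockMDP.valueFrom, TabularMDP.toBlock, eexp_pure]
      rw [← hact L i, show H - h - 1 = L by omega]
      congr 2
      funext s'
      exact ih (h + 1) s' (by omega)
  refine (ENNReal.ofReal_le_ofReal_iff (BlockMDP.value_nonneg _ H _)).1 ?_
  rw [BlockMDP.ofReal_value, BlockMDP.ofReal_value]
  have hinit : M'.toBlock.init = M.init.map α := rfl
  rw [hinit, eexp_map]
  exact eexp_mono _ fun s => (hup H 0 s).trans (hdown H 0 _ (zero_add H)).ge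

end Value

/-- Downstream guarantee for a PAC algorithm run through an approximately correct decoder. -/
theorem prob_runAlg_ge [Fintype A] [Nonempty A] {N : ℕ} {M : BlockMDP X S A} {α : S ≃ Fin N}
    {φ : X → Fin N} {ξ : ℝ} (hξ0 : 0 ≤ ξ) (hξ1 : ξ ≤ 1)
    (hξ : ∀ s, 1 - ξ ≤ prob (M.emit s) {x | φ x = α s})
    {alg : (N _H : ℕ) → (_ε _δ : ℝ) → EpisodicAlg (Fin N) A}
    {nsamp : (_S _A _H : ℕ) → (_ε _δ : ℝ) → ℕ} (hPAC : IsPAC alg nsamp) (H : ℕ) {ε δ : ℝ}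
    (hε : 0 < ε) (hδ0 : 0 < δ) (hδ1 : δ < 1) :
    1 - δ - H * nsamp N (Fintype.card A) H ε δ * ξ ≤
      prob (runAlg M H φ (alg N H ε δ) (nsamp N (Fintype.card A) H ε δ))
        {r | (∀ π : ℕ → X → A, M.value H π - M.value H (fun h x => r.2 h (φ x)) ≤ ε + H ^ 2 * ξ) ∧
          r.1.length = nsamp N (Fintype.card A) H ε δ} := by
  set m := nsamp N (Fintype.card A) H ε δ with hm
  set M' := M.toTabularMDP.relabel α with hM'
  set E : Set (List (Episode (Fin N) A) × (ℕ → Fin N → A)) :=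
    {r | ∀ ψ : ℕ → Fin N → A, M'.toBlock.value H ψ - M'.toBlock.value H r.2 ≤ ε} with hE
  -- The PAC guarantee concerns MDPs on `Fin N`, hence the relabeled latent MDP; the data-dependent
  -- `α` is harmless because the guarantee is uniform over MDPs.
  have hpac : 1 - δ ≤ prob (runAlg M'.toBlock H id (alg N H ε δ) m) E :=
    hPAC N H ε δ hε hδ0 hδ1 M'
  have hc : ∀ s, ENNReal.ofReal (1 - ξ) ≤ eexp (M.emit s) ({x | φ x = α s}.indicator 1) :=
    fun s => by
      rw [← ofReal_prob]
      exact ENNReal.ofReal_le_ofReal (hξ s)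
  have hdom : (1 - ξ) ^ (H * m) * prob (runAlg M'.toBlock H id (alg N H ε δ) m) E ≤
      prob (runAlg M H φ (alg N H ε δ) m) E := by
    refine (ENNReal.ofReal_le_ofReal_iff (prob_nonneg _ _)).1 ?_
    rw [ENNReal.ofReal_mul (pow_nonneg (by linarith) _), ENNReal.ofReal_pow (by linarith),
      ofReal_prob, ofReal_prob]
    exact eexp_runAlg_ge hc _ H m _
  have hb := one_add_mul_le_pow (show -2 ≤ -ξ by linarith) (H * m)
  rw [← sub_eq_add_neg] at hb
  have hle1 := prob_le_one (runAlg M'.toBlock H id (alg N H ε δ) m) E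
  have hstep : 1 - δ - H * m * ξ ≤ prob (runAlg M H φ (alg N H ε δ) m) E := by
    have h2 := mul_le_mul_of_nonneg_right hb (prob_nonneg (runAlg M'.toBlock H id (alg N H ε δ) m) E)
    have h3 : H * m * ξ * prob (runAlg M'.toBlock H id (alg N H ε δ) m) E ≤ H * m * ξ :=
      mul_le_of_le_one_right (by positivity) hle1
    push_cast at h2
    nlinarith
  refine hstep.trans (prob_mono_support _ fun r hr hrE => ⟨fun π => ?_, length_of_mem_runAlg hr⟩)
  obtain ⟨ψ, hψ⟩ := exists_policy_value_ge M α H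
  have h1 := hψ π
  have h2 := hrE ψ
  have h3 := value_comp_ge hξ0 hξ1 hξ r.2 H
  linarith

end VideoRL

/-! ### Sample size arithmetic and assembly. -/

namespace VideoRL

open scoped ENNReal

/-- Probability of an event in a two-stage experiment. -/
theorem prob_bind_map_ge {α β : Type*} {p : PMF α} {f : α → PMF β} {G : Set α} {E : Set (α × β)}
    {a b : ℝ} (hb : 0 ≤ b) (hG : a ≤ prob p G) (hE : ∀ x ∈ G, b ≤ prob (f x) {y | (x, y) ∈ E}) :
    a * b ≤ prob (p.bind fun x => (f x).map fun y => (x, y)) E := by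
  refine (mul_le_mul_of_nonneg_right hG hb).trans ?_
  refine (ENNReal.ofReal_le_ofReal_iff (prob_nonneg _ _)).1 ?_
  rw [ENNReal.ofReal_mul (prob_nonneg _ _), ofReal_prob, ofReal_prob, eexp_bind, ← eexp_mul_const]
  refine eexp_mono _ fun x => ?_
  by_cases hx : x ∈ G
  · rw [Set.indicator_of_mem hx, Pi.one_apply, one_mul, eexp_map]
    refine (ENNReal.ofReal_le_ofReal (hE x hx)).trans ?_
    rw [ofReal_prob]
    rfl
  · simp [hx]

/-- The sample size condition makes the failure rate of the decoder small enough for recovery of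
the states, for planning, and for running a downstream algorithm. -/
theorem sample_size_bounds {s h η β ε δ k L n : ℝ} (hs : 1 ≤ s) (hh : 0 < h) (hη : 0 < η)
    (hβ : 0 < β) (hε : 0 < ε) (hδ : 0 < δ) (hk : 0 ≤ k) (hL : 0 ≤ L) (hn : 0 < n)
    (hle : 256 * (s ^ 4 * h ^ 4 / (η ^ 4 * β ^ 2) + s ^ 6 * h ^ 8 / (ε ^ 2 * η ^ 4 * β ^ 2) +
      s ^ 6 * h ^ 6 * k ^ 2 / (δ ^ 2 * η ^ 4 * β ^ 2)) * L ≤ n) :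
    s ^ 2 * (h ^ 2 / η ^ 2 * (4 * √(1 / n * L) / β)) ≤ 1 / 4 ∧
    h ^ 2 * (s ^ 2 * (h ^ 2 / η ^ 2 * (4 * √(1 / n * L) / β))) ≤ ε / 4 ∧
    h * k * (s ^ 2 * (h ^ 2 / η ^ 2 * (4 * √(1 / n * L) / β))) ≤ δ / 4 := by
  set r := √(1 / n * L) with hr
  have hr0 : 0 ≤ r := Real.sqrt_nonneg _
  have hr2 : r ^ 2 = 1 / n * L := Real.sq_sqrt (by positivity)
  have hsum : 256 * (s ^ 4 * h ^ 4 / (η ^ 4 * β ^ 2) + s ^ 6 * h ^ 8 / (ε ^ 2 * η ^ 4 * β ^ 2) +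
      s ^ 6 * h ^ 6 * k ^ 2 / (δ ^ 2 * η ^ 4 * β ^ 2)) * r ^ 2 ≤ 1 := by
    rw [hr2, ← mul_assoc, mul_one_div, div_mul_eq_mul_div, div_le_one hn]
    exact hle
  have p1 : 0 ≤ s ^ 4 * h ^ 4 / (η ^ 4 * β ^ 2) * r ^ 2 := by positivity
  have p2 : 0 ≤ s ^ 6 * h ^ 8 / (ε ^ 2 * η ^ 4 * β ^ 2) * r ^ 2 := by positivity
  have p3 : 0 ≤ s ^ 6 * h ^ 6 * k ^ 2 / (δ ^ 2 * η ^ 4 * β ^ 2) * r ^ 2 := by positivity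
  set w := r / (η ^ 2 * β) with hw
  have hw0 : 0 ≤ w := by positivity
  -- Each summand of the sample size, times `256 * r ^ 2`, is a perfect square. Here `16 = 4 * 4`:
  -- one 4 sits in the decoding error, the other makes the targets quarters.
  have q1 : 16 * (s ^ 2 * h ^ 2 * w) ≤ 1 := by
    refine (sq_le_one_iff₀ (by positivity)).1 ?_
    have : (16 * (s ^ 2 * h ^ 2 * w)) ^ 2 = 256 * (s ^ 4 * h ^ 4 / (η ^ 4 * β ^ 2) * r ^ 2) := by
      rw [hw]
      field_simp
      ring
    linarith
  have q2 : 16 * (s ^ 3 * h ^ 4 * w) ≤ ε := by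
    rw [← div_le_one hε]
    refine (sq_le_one_iff₀ (by positivity)).1 ?_
    have : (16 * (s ^ 3 * h ^ 4 * w) / ε) ^ 2 =
        256 * (s ^ 6 * h ^ 8 / (ε ^ 2 * η ^ 4 * β ^ 2) * r ^ 2) := by
      rw [hw]
      field_simp
      ring
    linarith
  have q3 : 16 * (s ^ 3 * h ^ 3 * k * w) ≤ δ := by
    rw [← div_le_one hδ]
    refine (sq_le_one_iff₀ (by positivity)).1 ?_
    have : (16 * (s ^ 3 * h ^ 3 * k * w) / δ) ^ 2 =
        256 * (s ^ 6 * h ^ 6 * k ^ 2 / (δ ^ 2 * η ^ 4 * β ^ 2) * r ^ 2) := by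
      rw [hw]
      field_simp
      ring
    linarith
  have hξ : s ^ 2 * (h ^ 2 / η ^ 2 * (4 * r / β)) = 4 * (s ^ 2 * h ^ 2 * w) := by
    rw [hw]
    field_simp
  have hs23 : s ^ 2 ≤ s ^ 3 := pow_le_pow_right₀ hs (by norm_num)
  rw [hξ]
  refine ⟨by linarith, ?_, ?_⟩
  · have : s ^ 2 * (h ^ 4 * w) ≤ s ^ 3 * (h ^ 4 * w) := by gcongr
    linarith
  · have : s ^ 2 * (h ^ 3 * k * w) ≤ s ^ 3 * (h ^ 3 * k * w) := by gcongr
    linarith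

end VideoRL

open VideoProcess in
theorem mainTheorem2 : ∃ C : ℝ, 0 < C ∧
    ∀ (X S A : Type*) [Fintype S] [Fintype A] (H K : ℕ) [NeZero H]
      (P : VideoProcess X S A H K) (Pol : Set (ℕ → X → A)) (η β : ℝ)
      (_hη : 0 < η) (_hcov : P.Coverage Pol η) (_hfree : P.NoiseFree) (_hβ : P.Margin β)
      -- the model class and the decoder class, and realizability
      (G : Finset (Fin (Fintype.card S) → Fin K → X → Set.Icc (0 : ℝ) 1))
      (Φ : Finset (X → Fin (Fintype.card S)))
      (gstar : Fin (Fintype.card S) → Fin K → X → Set.Icc (0 : ℝ) 1) (_hg : gstar ∈ G)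
      (φcirc : X → Fin (Fintype.card S)) (_hφ : φcirc ∈ Φ)
      (_hreal : ∀ x k x', P.InSupport x k x' → (gstar (φcirc x) k x' : ℝ) = P.bayes x k x')
      -- the number of videos, and empirical risk minimization over pairs of videos
      (n : ℕ) (_hn : 2 ≤ n)
      (erm : (Fin (n / 2) → X × Fin K × X × Bool) →
        (Fin (Fintype.card S) → Fin K → X → Set.Icc (0 : ℝ) 1) × (X → Fin (Fintype.card S)))
      (_herm : IsERM G Φ erm)
      (δ : ℝ) (_hδ0 : 0 < δ) (_hδ1 : δ < 1),
      -- the Bayes classifier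
      (∀ x k x', P.InSupport x k x' →
        P.bayes x k x' =
          P.stateStep (P.env.decode x) k (P.env.decode x') /
            (P.stateStep (P.env.decode x) k (P.env.decode x') +
              P.rhoState (P.env.decode x'))) ∧
      -- the coupling bound, and the probability of merging different states
      (1 - δ ≤ prob (iid P.cont (n / 2))
        {data |
          expect P.coup (fun t =>
            if (erm data).2 t.1 = (erm data).2 t.2.1 then
              |(gstar (φcirc t.1) t.2.2.1 t.2.2.2 : ℝ) - gstar (φcirc t.2.1) t.2.2.1 t.2.2.2|
            else 0)
            < 4 * √(2 / (n : ℝ) * Real.log ((G.card : ℝ) * Φ.card / δ)) ∧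
          prob P.twoRho {p | (erm data).2 p.1 = (erm data).2 p.2 ∧
              P.env.decode p.1 ≠ P.env.decode p.2}
            ≤ 2 * √(2 / (n : ℝ) * Real.log ((G.card : ℝ) * Φ.card / δ)) / β}) ∧
      -- recovery of the latent state and downstream near-optimality
      (∀ (alg : (N _H : ℕ) → (_ε _δ : ℝ) → EpisodicAlg (Fin N) A)
        (nsamp : (_S _A _H : ℕ) → (_ε _δ : ℝ) → ℕ) (_hPAC : IsPAC alg nsamp)
        (ε : ℝ) (_hε : 0 < ε),
        C * ((Fintype.card S : ℝ) ^ 4 * (H : ℝ) ^ 4 / (η ^ 4 * β ^ 2)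
            + (Fintype.card S : ℝ) ^ 6 * (H : ℝ) ^ 8 / (ε ^ 2 * η ^ 4 * β ^ 2)
            + (Fintype.card S : ℝ) ^ 6 * (H : ℝ) ^ 6 *
                (nsamp (Fintype.card S) (Fintype.card A) H (ε / 2) (δ / 4) : ℝ) ^ 2 /
                  (δ ^ 2 * η ^ 4 * β ^ 2))
          * Real.log ((G.card : ℝ) * Φ.card / δ) ≤ (n : ℝ) →
        1 - δ ≤ prob
          (pipeline P (fun data => (erm data).2) (alg (Fintype.card S) H (ε / 2) (δ / 4))
            (nsamp (Fintype.card S) (Fintype.card A) H (ε / 2) (δ / 4)))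
          {r |
            (∃ α : S ≃ Fin (Fintype.card S), ∀ s : S,
              1 - 4 * (Fintype.card S : ℝ) ^ 3 * (H : ℝ) ^ 2 / (η ^ 2 * β) *
                  √(1 / (n : ℝ) * Real.log ((G.card : ℝ) * Φ.card / δ))
                ≤ prob (P.env.emit s) {x | (erm r.1).2 x = α s}) ∧
            (∀ π : ℕ → X → A,
              P.env.value H π - P.env.value H (fun h x => r.2.2 h ((erm r.1).2 x)) ≤ ε) ∧
            r.2.1.length = nsamp (Fintype.card S) (Fintype.card A) H (ε / 2) (δ / 4)}) := by
  refine ⟨256, by norm_num, ?_⟩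
  intro X S A _ _ H K _ P Pol η β hη hcov hfree hβ G Φ gstar hg φcirc hφ hreal n hn erm herm δ hδ0
    hδ1
  have hn0 : (0 : ℝ) < n := by positivity
  set F : ℝ := (G.card : ℝ) * Φ.card with hF
  have hF1 : 1 ≤ F := by
    have h1 : 1 ≤ G.card := Finset.card_pos.2 ⟨_, hg⟩
    have h2 : 1 ≤ Φ.card := Finset.card_pos.2 ⟨_, hφ⟩
    have : 1 ≤ G.card * Φ.card := Nat.one_le_iff_ne_zero.2 (by positivity)
    rw [hF]
    exact_mod_cast this
  have hL : 0 < Real.log (F / δ) := Real.log_pos ((one_lt_div hδ0).2 (hδ1.trans_le hF1))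
  have hzero : F < 2 → ∀ data, P.mergeGap (classifier gstar φcirc) (erm data).2 = 0 := by
    intro h data
    rw [erm_eq_of_card_lt_two hg hφ herm h data, mergeGap_eq_zero]
  refine ⟨fun x k x' h => bayes_eq_stateStep hfree h, ?_, ?_⟩
  · have key : 1 - δ ≤ prob (iid P.cont (n / 2)) {data |
        P.mergeGap (classifier gstar φcirc) (erm data).2 < 4 * √(2 / (n : ℝ) * Real.log (F / δ))} := by
      rcases lt_or_ge F 2 with h | h
      · refine le_trans (by linarith) (one_le_prob_of_forall_support _ fun data _ => ?_)
        rw [Set.mem_ofPred_eq, hzero h data]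
        positivity
      · exact mergeGap_erm_lt hg hφ hreal hn herm h hδ0 hδ1
    refine key.trans (prob_mono_support _ fun data _ hd => ⟨hd, ?_⟩)
    have h1 := (prob_merge_le hfree hβ hreal (erm data).2).trans_lt hd
    rw [le_div_iff₀ hβ.1]
    linarith
  · intro alg nsamp hPAC ε hε hC
    set m' := nsamp (Fintype.card S) (Fintype.card A) H (ε / 2) (δ / 4) with hm'
    set r := √(1 / (n : ℝ) * Real.log (F / δ)) with hr
    have hr0 : 0 ≤ r := Real.sqrt_nonneg _
    obtain ⟨s₀, -⟩ := P.env.init.support_nonempty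
    have hS : (1 : ℝ) ≤ Fintype.card S := by
      have : 0 < Fintype.card S := Fintype.card_pos_iff.2 ⟨s₀⟩
      exact_mod_cast this
    have hA : Nonempty A := by
      obtain ⟨_, π, _, _⟩ := hcov.1 s₀
      obtain ⟨x, -⟩ := (P.env.emit s₀).support_nonempty
      exact ⟨π 0 x⟩
    have hH : (0 : ℝ) < H := by exact_mod_cast NeZero.pos H
    obtain ⟨b1, b2, b3⟩ := sample_size_bounds hS hH hη hβ.1 hε hδ0 (Nat.cast_nonneg m') hL.le hn0 hC
    -- The data stage gets failure probability `δ / 2`. Replacing `δ` by `δ / 2` at most doubles the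
    -- logarithm when `F ≥ 2`, which gives the bound `8 * r`.
    have hdata : 1 - δ / 2 ≤ prob (iid P.cont (n / 2)) {data |
        P.mergeGap (classifier gstar φcirc) (erm data).2 ≤ 8 * r} := by
      rcases lt_or_ge F 2 with h | h
      · refine le_trans (by linarith) (one_le_prob_of_forall_support _ fun data _ => ?_)
        rw [Set.mem_ofPred_eq, hzero h data]
        positivity
      · refine (mergeGap_erm_lt hg hφ hreal hn herm h (half_pos hδ0) (by linarith)).trans
          (prob_mono_support _ fun data _ hd => ?_)
        change P.mergeGap (classifier gstar φcirc) (erm data).2 ≤ 8 * r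
        refine (le_of_lt hd).trans ?_
        have hlog : Real.log (F / (δ / 2)) ≤ 2 * Real.log (F / δ) := by
          have h2 : Real.log 2 ≤ Real.log (F / δ) := Real.log_le_log two_pos
            ((le_div_iff₀ hδ0).2 (by nlinarith))
          rw [show F / (δ / 2) = 2 * (F / δ) by field_simp, Real.log_mul two_ne_zero (by positivity)]
          linarith
        have h8 : 8 * r = 4 * √(2 / (n : ℝ) * (2 * Real.log (F / δ))) := by
          rw [hr, show 2 / (n : ℝ) * (2 * Real.log (F / δ)) = 2 ^ 2 * (1 / n * Real.log (F / δ)) by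
            ring, Real.sqrt_mul (sq_nonneg (2 : ℝ)), Real.sqrt_sq zero_le_two]
          ring
        rw [h8]
        gcongr
    set ξ : ℝ := (Fintype.card S : ℝ) ^ 2 * ((H : ℝ) ^ 2 / η ^ 2 * (4 * r / β)) with hξ
    have hβ0 := hβ.1
    have hξ0 : 0 ≤ ξ := by positivity
    -- The downstream stage also fails with probability at most `δ / 2`: `δ / 4` from the PAC
    -- algorithm and `δ / 4` from decoding errors in its `H * m'` steps.
    refine le_trans (show 1 - δ ≤ (1 - δ / 2) * (1 - δ / 2) by nlinarith)
      (prob_bind_map_ge (by linarith) hdata fun data hd => ?_)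
    have hmerge : prob P.twoRho {p | (erm data).2 p.1 = (erm data).2 p.2 ∧
        P.env.decode p.1 ≠ P.env.decode p.2} ≤ 4 * r / β := by
      have h1 := (prob_merge_le hfree hβ hreal (erm data).2).trans hd
      rw [le_div_iff₀ hβ0]
      linarith
    obtain ⟨α, hα⟩ := exists_equiv_of_prob_merge_le hfree hη hcov (erm data).2 hmerge
      (by linarith)
    have hrun := prob_runAlg_ge hξ0 (by linarith) hα hPAC H (half_pos hε)
      (show 0 < δ / 4 by linarith) (by linarith)
    refine le_trans (by linarith) (hrun.trans (prob_mono_support _ fun r' _ hr' =>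
      ⟨⟨α, fun s => le_trans ?_ (hα s)⟩, fun π => (hr'.1 π).trans (by linarith), hr'.2⟩))
    have hx : ξ ≤ 4 * (Fintype.card S : ℝ) ^ 3 * (H : ℝ) ^ 2 / (η ^ 2 * β) * r := by
      have hs23 : (Fintype.card S : ℝ) ^ 2 ≤ (Fintype.card S : ℝ) ^ 3 :=
        pow_le_pow_right₀ hS (by norm_num)
      calc ξ = (Fintype.card S : ℝ) ^ 2 * (4 * (H : ℝ) ^ 2 / (η ^ 2 * β) * r) := by
            rw [hξ]
            field_simp
        _ ≤ (Fintype.card S : ℝ) ^ 3 * (4 * (H : ℝ) ^ 2 / (η ^ 2 * β) * r) := by gcongr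
        _ = _ := by ring
    linarith
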